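/- Let $\alpha>0$, $0<p<\infty$, and let $g,\psi:\mathbb{C}\to\mathbb{C}$ be entire functions. Let $dm$ denote Lebesgue area measure on $\mathbb{C}$, and let $\mathcal{F}_\alpha^2$ be the Fock space, i.e. the Hilbert space of entire functions $f$ with $$\|f\|^2=\frac{\alpha}{\pi}\int_{\mathbb{C}}|f(z)|^2e^{-\alpha|z|^2}\,dm(z)<\infty .$$ For entire $f$ put $$I_{(g,\psi)}f(z)=\int_0^z f'(\psi(w))\,g(w)\,dw,\qquad C_{(g,\psi)}f(z)=\int_0^{\psi(z)} f'(w)\,g(w)\,dw .$$ Let $\mathcal{S}_p$ be the Schatten class of $\mathcal{F}_\alpha^2$, i.e. the set of all compact operators $T$ on $\mathcal{F}_\alpha^2$ with a Schmidt decomposition $Tf=\sum_n s_n\langle f,e_n\rangle u_n$, where $(e_n)$ and $(u_n)$ are orthonormal systems (finite or countable), $s_n\ge 0$ and $\sum_n s_n^p<\infty$. An operator such as $I_{(g,\psi)}$ is said to belong to $\mathcal{S}_p$ if it maps $\mathcal{F}_\alpha^2$ boundedly into itself and the resulting bounded operator is in $\mathcal{S}_p$. Then: (i) if $\psi$ is not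 constant, $I_{(g,\psi)}$ belongs to $\mathcal{S}_p$ if and only if $$\int_{\mathbb{C}}|g(z)|^p e^{\frac{p\alpha}{2}(|\psi(z)|^2-|z|^2)}\,dm(z)<\infty ;$$ (ii) $C_{(g,\psi)}$ belongs to $\mathcal{S}_p$ if and only if $$\int_{\mathbb{C}}|g(\psi(z))|^p e^{\frac{p\alpha}{2}(|\psi(z)|^2-|z|^2)}\,dm(z)<\infty .$$ -/

import Mathlib

open MeasureTheory

noncomputable section

namespace FockVolterra

/-- The Gaussian measure `(α / π) e^{-α |z|²} dm(z)` on `ℂ`, with `m` the Lebesgue area measure. -/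
def gaussianMeasure (α : ℝ) : Measure ℂ :=
  volume.withDensity fun z => ENNReal.ofReal (α / Real.pi * Real.exp (-α * ‖z‖ ^ 2))

/-- The classical Fock space `F_α²`: the entire functions `f` with
`‖f‖² = (α / π) ∫ |f(z)|² e^{-α |z|²} dm(z) < ∞`, with the inner product of `L²` of the Gaussian
measure. It is realized as the subspace of those elements of `L²` that have an entire
representative (for `α > 0` this representative is unique). -/
def FockSpace (α : ℝ) : Submodule ℂ (Lp ℂ 2 (gaussianMeasure α)) where
  carrier := {f | ∃ F : ℂ → ℂ, Differentiable ℂ F ∧ f =ᵐ[gaussianMeasure α] F}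
  zero_mem' := ⟨0, differentiable_const 0, Lp.coeFn_zero _ _ _⟩
  add_mem' := by
    rintro f h ⟨F, hF, hfF⟩ ⟨H, hH, hhH⟩
    exact ⟨F + H, hF.add hH, (Lp.coeFn_add f h).trans (hfF.add hhH)⟩
  smul_mem' := by
    rintro c f ⟨F, hF, hfF⟩
    exact ⟨c • F, hF.const_smul c, (Lp.coeFn_smul c f).trans (hfF.const_smul c)⟩

/-- The complex line integral `∫_0^z h(w) dw` along the segment from `0` to `z`
(for entire `h` it does not depend on the path). -/
def lineIntegral (h : ℂ → ℂ) (z : ℂ) : ℂ :=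
  z * ∫ t in (0 : ℝ)..1, h (t * z)

/-- `I_{(g,ψ)} f(z) = ∫_0^z f'(ψ(w)) g(w) dw`. -/
def companionI (g ψ : ℂ → ℂ) (f : ℂ → ℂ) (z : ℂ) : ℂ :=
  lineIntegral (fun w => deriv f (ψ w) * g w) z

/-- `C_{(g,ψ)} f(z) = ∫_0^{ψ(z)} f'(w) g(w) dw`. -/
def companionC (g ψ : ℂ → ℂ) (f : ℂ → ℂ) (z : ℂ) : ℂ :=
  lineIntegral (fun w => deriv f w * g w) (ψ z)

/-- The Schatten class `S_p(H)`, `0 < p < ∞`: the compact operators with a Schmidt decomposition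
`T x = ∑ₙ sₙ ⟨x, eₙ⟩ uₙ`, where `(eₙ)` and `(uₙ)` are orthonormal systems with the same finite or
countable index set, `sₙ ≥ 0`, and `∑ₙ sₙ^p < ∞`. -/
def IsSchatten {H : Type*} [NormedAddCommGroup H] [InnerProductSpace ℂ H]
    (p : ℝ) (T : H →L[ℂ] H) : Prop :=
  IsCompactOperator T ∧
    ∃ (J : Set ℕ) (e u : J → H) (s : J → ℝ),
      Orthonormal ℂ e ∧ Orthonormal ℂ u ∧ (∀ n, 0 ≤ s n) ∧
      (∀ x : H, HasSum (fun n => ((s n : ℂ) * inner ℂ (e n) x) • u n) (T x)) ∧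
      Summable fun n => s n ^ p

/-- The map `A` on entire functions acts as a bounded operator `F_α² → F_α²` that belongs to
`S_p(F_α²)`: there is a bounded operator `T` in `S_p(F_α²)` such that `T f = A f` for every entire
function `f` in `F_α²`. -/
def ActsInSchatten (α p : ℝ) (A : (ℂ → ℂ) → ℂ → ℂ) : Prop :=
  ∃ T : FockSpace α →L[ℂ] FockSpace α,
    (∀ (f : FockSpace α) (F : ℂ → ℂ), Differentiable ℂ F →
      (f : Lp ℂ 2 (gaussianMeasure α)) =ᵐ[gaussianMeasure α] F →
      (T f : Lp ℂ 2 (gaussianMeasure α)) =ᵐ[gaussianMeasure α] A F) ∧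
    IsSchatten p T

end FockVolterra

end

/-!
An operator `A` of either kind is determined by `(A f)' = (f' ∘ ψ) G` and by the value `(A f)(0)`,
where `G = g` for `I_{(g,ψ)}` and `G = (g ∘ ψ) ψ'` for `C_{(g,ψ)}` (`IsVolterra`). The Fock norm is
equivalent to `|f(0)|² + ∫ |f'(z)|² / N(z) dm(z)`, where `N(z) = α (1 + α |z|²) e^{α |z|²}` is the
squared norm of the functional `f ↦ f'(z)`; both sides are diagonal in the Taylor coefficients. So
the normalized vectors `k_z` representing these functionals, together with the constant `1`, form a
continuous frame indexed by `ℂ ⊕ Unit`, and `⟨k_z, A f⟩ = φ(z) ⟨η_z, f⟩` with `η_z = k_{ψ(z)}` and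
`|φ(z)|^p = |G(z)|^p e^{(pα/2)(|ψ(z)|² - |z|²)} ((1 + α |ψ(z)|²) / (1 + α |z|²))^{p/2}`.

If `A` is bounded then `φ` is bounded, because `φ(z) = ⟨k_z, A k_{ψ(z)}⟩`. If `G` does not vanish
identically, this makes `ψ` affine: Jensen's formula bounds the circle means of `log |G|` from
below, hence the circle means of `|ψ|²` grow at most like `r²` (`exists_affine_of_le`).
Integrability of the weight has the same consequence (`exists_affine_of_lintegral`). For nonconstant
affine `ψ` the vectors `η_z` satisfy the upper frame bound as well, after a change of variables, and
the ratio `(1 + α |ψ|²) / (1 + α |z|²)` lies between positive constants, so that the weight is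
integrable exactly when `φ ∈ L^p`.

The criterion `A ∈ S_p ↔ φ ∈ L^p` is a statement on frames alone (`FrameData.lintegral_lt_top`,
`FrameData.isSchatten`). A Schmidt decomposition `A = ∑ sₙ ⟨·, eₙ⟩ uₙ` gives
`|φ(x)|² |⟨η_x, eₙ⟩|² = sₙ² |⟨k_x, uₙ⟩|²`. Summing over `n` expresses `|φ|²` through the `sₙ²`, and
integrating over `x` expresses `sₙ²` through `|φ|²`. Weighted means of powers with exponent `p/2`
are compared by Jensen's or Hölder's inequality, according as `p ≥ 2` or `p ≤ 2`, with constants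
that come from the frame bounds. Compactness follows from `φ ∈ L^q` for some `q ≥ 2`
(`FrameData.exists_isCompactOperator`); for `p < 2` one may take `q = 2`, since an integrable weight
with affine `ψ` is bounded, by subharmonicity of powers of the modulus of an entire function
(`exists_weight_le`).

For `C_{(g,ψ)}` the factor `ψ'` in `G` is harmless, being a nonzero constant in the affine case.
When `ψ` is constant, the operator has rank at most one and the integral is Gaussian.
-/

noncomputable section

namespace FockVolterra

open scoped ENNReal

/-! ### Jensen's inequality for weighted integrals and sums -/

section Jensen

variable {X : Type*} [MeasurableSpace X] {μ : Measure X}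

lemma rpow_lintegral_le_of_one_le {C : ℝ≥0∞} (hμ : μ Set.univ ≤ C) {f : X → ℝ≥0∞}
    (hf : Measurable f) {r : ℝ} (hr : 1 ≤ r) :
    (∫⁻ x, f x ∂μ) ^ r ≤ C ^ (r - 1) * ∫⁻ x, f x ^ r ∂μ := by
  rcases hr.eq_or_lt with rfl | hr
  · simp
  have h := ENNReal.lintegral_mul_le_Lp_mul_Lq μ (Real.HolderConjugate.conjExponent hr)
    hf.aemeasurable (aemeasurable_const (b := (1 : ℝ≥0∞)))
  have hr0 : (0 : ℝ) < r := by linarith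
  simp only [Pi.mul_apply, mul_one, ENNReal.one_rpow, lintegral_const, one_mul] at h
  calc (∫⁻ x, f x ∂μ) ^ r
      ≤ ((∫⁻ x, f x ^ r ∂μ) ^ (1 / r) * μ Set.univ ^ (1 / r.conjExponent)) ^ r := by gcongr
    _ = (∫⁻ x, f x ^ r ∂μ) * μ Set.univ ^ (r - 1) := by
        rw [ENNReal.mul_rpow_of_nonneg _ _ hr0.le, ← ENNReal.rpow_mul, ← ENNReal.rpow_mul,
          one_div_mul_cancel hr0.ne', ENNReal.rpow_one]
        congr 2
        rw [Real.conjExponent]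
        have : r - 1 ≠ 0 := by linarith
        field_simp
    _ ≤ C ^ (r - 1) * ∫⁻ x, f x ^ r ∂μ := by
        rw [mul_comm]
        gcongr

lemma lintegral_rpow_le_of_le_one {C : ℝ≥0∞} (hμ : μ Set.univ ≤ C) {f : X → ℝ≥0∞}
    (hf : Measurable f) {r : ℝ} (hr0 : 0 < r) (hr : r ≤ 1) :
    ∫⁻ x, f x ^ r ∂μ ≤ C ^ (1 - r) * (∫⁻ x, f x ∂μ) ^ r := by
  have h := rpow_lintegral_le_of_one_le hμ (hf.pow_const r) ((one_le_inv₀ hr0).2 hr)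
  simp only [← ENNReal.rpow_mul, mul_inv_cancel₀ hr0.ne', ENNReal.rpow_one] at h
  calc ∫⁻ x, f x ^ r ∂μ = ((∫⁻ x, f x ^ r ∂μ) ^ r⁻¹) ^ r := by
        rw [← ENNReal.rpow_mul, inv_mul_cancel₀ hr0.ne', ENNReal.rpow_one]
    _ ≤ (C ^ (r⁻¹ - 1) * ∫⁻ x, f x ∂μ) ^ r := by gcongr
    _ = C ^ (1 - r) * (∫⁻ x, f x ∂μ) ^ r := by
        rw [ENNReal.mul_rpow_of_nonneg _ _ hr0.le, ← ENNReal.rpow_mul, sub_mul,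
          inv_mul_cancel₀ hr0.ne', one_mul]

/-- Jensen's inequality for the convex function `x ↦ x ^ r` and a weight of total mass at most
`C`. -/
lemma rpow_lintegral_mul_le {C : ℝ≥0∞} {f w : X → ℝ≥0∞} (hf : Measurable f) (hw : Measurable w)
    (hC : ∫⁻ x, w x ∂μ ≤ C) {r : ℝ} (hr : 1 ≤ r) :
    (∫⁻ x, f x * w x ∂μ) ^ r ≤ C ^ (r - 1) * ∫⁻ x, f x ^ r * w x ∂μ := by
  have h := rpow_lintegral_le_of_one_le (μ := μ.withDensity w) (C := C)
    (by simpa [withDensity_apply] using hC) hf hr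
  rw [lintegral_withDensity_eq_lintegral_mul _ hw hf,
    lintegral_withDensity_eq_lintegral_mul _ hw (hf.pow_const r)] at h
  simpa [mul_comm] using h

/-- Jensen's inequality for the concave function `x ↦ x ^ r` and a weight of total mass at most
`C`. -/
lemma lintegral_rpow_mul_le {C : ℝ≥0∞} {f w : X → ℝ≥0∞} (hf : Measurable f) (hw : Measurable w)
    (hC : ∫⁻ x, w x ∂μ ≤ C) {r : ℝ} (hr0 : 0 < r) (hr : r ≤ 1) :
    ∫⁻ x, f x ^ r * w x ∂μ ≤ C ^ (1 - r) * (∫⁻ x, f x * w x ∂μ) ^ r := by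
  have h := lintegral_rpow_le_of_le_one (μ := μ.withDensity w) (C := C)
    (by simpa [withDensity_apply] using hC) hf hr0 hr
  rw [lintegral_withDensity_eq_lintegral_mul _ hw hf,
    lintegral_withDensity_eq_lintegral_mul _ hw (hf.pow_const r)] at h
  simpa [mul_comm] using h

lemma rpow_tsum_mul_le {ι : Type*} {f w : ι → ℝ≥0∞} (hw : ∑' i, w i ≤ 1) {r : ℝ} (hr : 1 ≤ r) :
    (∑' i, f i * w i) ^ r ≤ ∑' i, f i ^ r * w i := by
  let _ : MeasurableSpace ι := ⊤
  have h := rpow_lintegral_mul_le (μ := Measure.count) (C := 1) (f := f) (w := w)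
    measurable_from_top measurable_from_top (by rwa [lintegral_count]) hr
  simpa [lintegral_count] using h

lemma tsum_rpow_mul_le {ι : Type*} {f w : ι → ℝ≥0∞} (hw : ∑' i, w i ≤ 1) {r : ℝ} (hr0 : 0 < r)
    (hr : r ≤ 1) : ∑' i, f i ^ r * w i ≤ (∑' i, f i * w i) ^ r := by
  let _ : MeasurableSpace ι := ⊤
  have h := lintegral_rpow_mul_le (μ := Measure.count) (C := 1) (f := f) (w := w)
    measurable_from_top measurable_from_top (by rwa [lintegral_count]) hr0 hr
  simpa [lintegral_count] using h

end Jensen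

/-! ### Comparing sums over singular values with integrals over a frame -/

section Comparison

variable {X : Type*} [MeasurableSpace X] {μ : Measure X} {ι : Type*} [Countable ι]
  {A : X → ℝ≥0∞} {t b : ι → X → ℝ≥0∞} {s : ι → ℝ≥0∞} {c C : ℝ≥0∞}

lemma sq_rpow_half (x : ℝ≥0∞) (p : ℝ) : (x ^ 2) ^ (p / 2) = x ^ p := by
  rw [← ENNReal.rpow_natCast, ← ENNReal.rpow_mul]
  congr 1
  push_cast
  ring

/-- The `L^p` norm of `A` is controlled by the `ℓ^p` norm of `s` when `A² tᵢ = sᵢ² bᵢ` for weights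
`tᵢ` that form a partition of unity where `A` does not vanish, and weights `bᵢ` of sum at most one.
For `p ≥ 2` Jensen's inequality is applied to the sum over `i`, for `p ≤ 2` to the integrals. -/
lemma lintegral_rpow_le_tsum (hA : Measurable A) (ht : ∀ i, Measurable (t i))
    (hb : ∀ i, Measurable (b i)) (h1 : ∀ i x, A x ^ 2 * t i x = s i ^ 2 * b i x)
    (h2 : ∀ x, A x ≠ 0 → ∑' i, t i x = 1) (h3 : ∀ x, ∑' i, b i x ≤ 1)
    (htC : ∀ i, ∫⁻ x, t i x ∂μ ≤ C) (hbC : ∀ i, ∫⁻ x, b i x ∂μ ≤ C) (hC : C ≠ 0)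
    (hC' : C ≠ ⊤) {p : ℝ} (hp : 0 < p) :
    ∫⁻ x, A x ^ p ∂μ ≤ C * ∑' i, s i ^ p := by
  have hA2 (x : X) (q : ℝ) (hq : 0 < q) : A x ^ q = ∑' i, A x ^ q * t i x := by
    rw [ENNReal.tsum_mul_left]
    rcases eq_or_ne (A x) 0 with h | h
    · simp [h, hq]
    · rw [h2 x h, mul_one]
  rcases le_total 2 p with hp2 | hp2
  · calc ∫⁻ x, A x ^ p ∂μ ≤ ∫⁻ x, ∑' i, s i ^ p * b i x ∂μ := by
          refine lintegral_mono fun x => ?_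
          calc A x ^ p = (∑' i, s i ^ 2 * b i x) ^ (p / 2) := by
                rw [← sq_rpow_half, ← ENNReal.rpow_natCast, Nat.cast_two, hA2 x 2 two_pos]
                congr 2
                ext i
                rw [← h1, ← ENNReal.rpow_natCast, Nat.cast_two]
            _ ≤ ∑' i, (s i ^ 2) ^ (p / 2) * b i x := rpow_tsum_mul_le (h3 x) (by linarith)
            _ = _ := by simp only [sq_rpow_half]
      _ = ∑' i, s i ^ p * ∫⁻ x, b i x ∂μ := by
          rw [lintegral_tsum fun i => ((hb i).const_mul _).aemeasurable]
          congr 1 with i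
          rw [lintegral_const_mul _ (hb i)]
      _ ≤ ∑' i, s i ^ p * C := by gcongr with i; exact hbC i
      _ = C * ∑' i, s i ^ p := by rw [ENNReal.tsum_mul_right, mul_comm]
  · calc ∫⁻ x, A x ^ p ∂μ = ∑' i, ∫⁻ x, A x ^ p * t i x ∂μ := by
          rw [← lintegral_tsum (f := fun i x => A x ^ p * t i x)
            fun i => ((hA.pow_const p).mul (ht i)).aemeasurable]
          exact lintegral_congr fun x => hA2 x p hp
      _ ≤ ∑' i, C * s i ^ p := by
          gcongr with i
          calc ∫⁻ x, A x ^ p * t i x ∂μ = ∫⁻ x, (A x ^ 2) ^ (p / 2) * t i x ∂μ := by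
                simp only [sq_rpow_half]
            _ ≤ C ^ (1 - p / 2) * (∫⁻ x, A x ^ 2 * t i x ∂μ) ^ (p / 2) :=
                lintegral_rpow_mul_le (hA.pow_const 2) (ht i) (htC i) (by linarith) (by linarith)
            _ = C ^ (1 - p / 2) * (s i ^ 2 * ∫⁻ x, b i x ∂μ) ^ (p / 2) := by
                simp only [h1, lintegral_const_mul _ (hb i)]
            _ ≤ C ^ (1 - p / 2) * (s i ^ 2 * C) ^ (p / 2) := by
                gcongr
                exact hbC i
            _ = C * s i ^ p := by
                rw [ENNReal.mul_rpow_of_nonneg _ _ (by linarith), sq_rpow_half, mul_comm (s i ^ p),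
                  ← mul_assoc, ← ENNReal.rpow_add _ _ hC hC', sub_add_cancel, ENNReal.rpow_one]
      _ = C * ∑' i, s i ^ p := ENNReal.tsum_mul_left

/-- Converse of `lintegral_rpow_le_tsum`, for weights `bᵢ` whose integrals are bounded below. Here
Jensen's inequality is applied to the integrals for `p ≥ 2` and to the sum over `i` for `p ≤ 2`. -/
lemma tsum_rpow_lt_top (hA : Measurable A) (ht : ∀ i, Measurable (t i))
    (hb : ∀ i, Measurable (b i)) (h1 : ∀ i x, A x ^ 2 * t i x = s i ^ 2 * b i x)
    (h2 : ∀ x, ∑' i, t i x ≤ 1) (h3 : ∀ x, ∑' i, b i x ≤ 1)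
    (htC : ∀ i, ∫⁻ x, t i x ∂μ ≤ C) (hbc : ∀ i, c ≤ ∫⁻ x, b i x ∂μ) (hc : c ≠ 0)
    (hC' : C ≠ ⊤) {p : ℝ} (hp : 0 < p) (hAp : ∫⁻ x, A x ^ p ∂μ < ⊤) :
    ∑' i, s i ^ p < ⊤ := by
  have key {K L : ℝ≥0∞} (hK : K ≠ 0) (hL : L ≠ ⊤)
      (h : K * ∑' i, s i ^ p ≤ L * ∫⁻ x, A x ^ p ∂μ) : ∑' i, s i ^ p < ⊤ := by
    refine lt_top_iff_ne_top.2 fun h' => ?_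
    rw [h', ENNReal.mul_top hK] at h
    exact (ENNReal.mul_lt_top hL.lt_top hAp).not_ge h
  rcases le_total 2 p with hp2 | hp2
  · refine key (K := c ^ (p / 2)) (L := C ^ (p / 2 - 1))
      (by simp [hc, ENNReal.rpow_eq_zero_iff]; intros; linarith)
      (ENNReal.rpow_ne_top_of_nonneg (by linarith) hC') ?_
    calc c ^ (p / 2) * ∑' i, s i ^ p = ∑' i, (s i ^ 2 * c) ^ (p / 2) := by
          rw [← ENNReal.tsum_mul_left]
          congr 1 with i
          rw [ENNReal.mul_rpow_of_nonneg _ _ (by linarith), sq_rpow_half, mul_comm]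
      _ ≤ ∑' i, (∫⁻ x, A x ^ 2 * t i x ∂μ) ^ (p / 2) := by
          gcongr with i
          simp only [h1, lintegral_const_mul _ (hb i)]
          gcongr
          exact hbc i
      _ ≤ ∑' i, C ^ (p / 2 - 1) * ∫⁻ x, A x ^ p * t i x ∂μ := by
          gcongr with i
          simpa only [sq_rpow_half] using
            rpow_lintegral_mul_le (hA.pow_const (2 : ℕ)) (ht i) (htC i) (r := p / 2) (by linarith)
      _ = C ^ (p / 2 - 1) * ∫⁻ x, A x ^ p * ∑' i, t i x ∂μ := by
          rw [ENNReal.tsum_mul_left,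
            ← lintegral_tsum (f := fun i x => A x ^ p * t i x)
            fun i => ((hA.pow_const p).mul (ht i)).aemeasurable]
          simp only [ENNReal.tsum_mul_left]
      _ ≤ C ^ (p / 2 - 1) * ∫⁻ x, A x ^ p ∂μ := by
          gcongr with x
          exact mul_le_of_le_one_right' (h2 x)
  · refine key (K := c) (L := 1) hc (by simp) ?_
    calc c * ∑' i, s i ^ p ≤ ∑' i, s i ^ p * ∫⁻ x, b i x ∂μ := by
          rw [mul_comm, ← ENNReal.tsum_mul_right]
          gcongr with i
          exact hbc i
      _ = ∫⁻ x, ∑' i, (s i ^ 2) ^ (p / 2) * b i x ∂μ := by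
          rw [lintegral_tsum fun i => ((hb i).const_mul _).aemeasurable]
          simp only [sq_rpow_half]
          congr 1 with i
          rw [lintegral_const_mul _ (hb i)]
      _ ≤ ∫⁻ x, (∑' i, A x ^ 2 * t i x) ^ (p / 2) ∂μ := by
          gcongr with x
          simp only [h1]
          exact tsum_rpow_mul_le (h3 x) (by linarith) (by linarith)
      _ ≤ 1 * ∫⁻ x, A x ^ p ∂μ := by
          rw [one_mul]
          gcongr with x
          rw [ENNReal.tsum_mul_left, ← sq_rpow_half (A x)]
          exact ENNReal.rpow_le_rpow (mul_le_of_le_one_right' (h2 x)) (by linarith)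

end Comparison

/-! ### Schmidt decompositions of compact operators -/

section Schmidt

universe v

variable {H : Type v} [NormedAddCommGroup H] [InnerProductSpace ℂ H]

lemma tsum_enorm_inner_sq_le {ι : Type*} {v : ι → H} (hv : Orthonormal ℂ v) (x : H) :
    ∑' i, ‖inner ℂ x (v i)‖ₑ ^ 2 ≤ ‖x‖ₑ ^ 2 := by
  have h := hv.inner_products_summable x
  have h' := hv.tsum_inner_products_le x
  calc ∑' i, ‖inner ℂ x (v i)‖ₑ ^ 2 = ∑' i, ENNReal.ofReal (‖inner ℂ (v i) x‖ ^ 2) := by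
        congr 1 with i
        rw [norm_inner_symm, ENNReal.ofReal_pow (norm_nonneg _), ofReal_norm]
    _ = ENNReal.ofReal (∑' i, ‖inner ℂ (v i) x‖ ^ 2) :=
        (ENNReal.ofReal_tsum_of_nonneg (fun i => sq_nonneg _) h).symm
    _ ≤ ENNReal.ofReal (‖x‖ ^ 2) := ENNReal.ofReal_le_ofReal h'
    _ = ‖x‖ₑ ^ 2 := by rw [ENNReal.ofReal_pow (norm_nonneg _), ofReal_norm]

lemma countable_of_orthonormal [TopologicalSpace.SeparableSpace H] {ι : Type*} {v : ι → H}
    (hv : Orthonormal ℂ v) : Countable ι := by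
  refine Set.countable_univ_iff.1 (Set.PairwiseDisjoint.countable_of_isOpen
    (s := fun i => Metric.ball (v i) (1 / 2)) (a := Set.univ) ?_ (fun _ _ => Metric.isOpen_ball)
    fun i _ => ⟨v i, by simp⟩)
  intro i _ j _ hij
  refine Metric.ball_disjoint_ball ?_
  have h : ‖v i - v j‖ ^ 2 = 2 := by
    rw [@norm_sub_sq ℂ, hv.1, hv.1, hv.2 hij]
    norm_num
  rw [dist_eq_norm]
  nlinarith [norm_nonneg (v i - v j)]

/-- A Hilbert space has a Hilbert basis of eigenvectors of `T* T` when `T` is compact. -/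
lemma exists_hilbertBasis_eigenvectors [CompleteSpace H] {T : H →L[ℂ] H}
    (hT : IsCompactOperator T) :
    ∃ (ι : Type v) (v : HilbertBasis ι ℂ H) (m : ι → ℂ),
      ∀ i, (ContinuousLinearMap.adjoint T) (T (v i)) = m i • v i := by
  set S : H →L[ℂ] H := (ContinuousLinearMap.adjoint T).comp T with hS
  have hSc : IsCompactOperator S := hT.clm_comp (ContinuousLinearMap.adjoint T)
  have hSs : (S : H →ₗ[ℂ] H).IsSymmetric := by
    intro x y
    simp [hS, ContinuousLinearMap.adjoint_inner_left, ContinuousLinearMap.adjoint_inner_right]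
  have hbot := ContinuousLinearMap.orthogonalComplement_iSup_eigenspaces_eq_bot hSc hSs
  have hcl (μ : ℂ) : CompleteSpace (Module.End.eigenspace (S : Module.End ℂ H) μ) := by
    have : IsClosed (Module.End.eigenspace (S : Module.End ℂ H) μ : Set H) := by
      have : (Module.End.eigenspace (S : Module.End ℂ H) μ : Set H) = {x | S x = μ • x} := by
        ext x
        simp
      rw [this]
      exact isClosed_eq S.continuous (continuous_const_smul μ)
    exact this.completeSpace_coe
  choose w b hb using fun μ => exists_hilbertBasis ℂ (Module.End.eigenspace (S : Module.End ℂ H) μ)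
  have hv := (hSs.orthogonalFamily_eigenspaces).orthonormal_sigma_orthonormal
    (v_family := fun μ => b μ) fun μ => (b μ).orthonormal
  have hsp : (Submodule.span ℂ (Set.range fun a : Σ μ, w μ =>
      (Module.End.eigenspace (S : Module.End ℂ H) a.1).subtypeₗᵢ (b a.1 a.2)))ᗮ = ⊥ := by
    rw [eq_bot_iff, ← hbot, ← Submodule.iInf_orthogonal]
    intro x hx
    rw [Submodule.mem_iInf]
    intro μ
    rw [Submodule.mem_orthogonal']
    intro y hy
    have h := (((b μ).hasSum_repr ⟨y, hy⟩).mapL (Submodule.subtypeL _)).mapL (innerSL ℂ x)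
    refine h.unique ?_
    convert! hasSum_zero with i
    have hxi := (Submodule.mem_orthogonal' _ _).1 hx _ (Submodule.subset_span ⟨⟨μ, i⟩, rfl⟩)
    simp only [Submodule.coe_subtypeₗᵢ, Submodule.subtype_apply] at hxi
    simp [hxi]
  refine ⟨Σ μ, w μ, HilbertBasis.mkOfOrthogonalEqBot hv hsp, fun a => a.1, fun a => ?_⟩
  rw [HilbertBasis.coe_mkOfOrthogonalEqBot]
  exact Module.End.mem_eigenspace_iff.1 (b a.1 a.2).2

/-- Every compact operator of a separable Hilbert space has a Schmidt decomposition. -/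
lemma exists_schmidt [CompleteSpace H] [TopologicalSpace.SeparableSpace H] {T : H →L[ℂ] H}
    (hT : IsCompactOperator T) :
    ∃ (J : Set ℕ) (e u : J → H) (s : J → ℝ),
      Orthonormal ℂ e ∧ Orthonormal ℂ u ∧ (∀ n, 0 ≤ s n) ∧
      (∀ x : H, HasSum (fun n => ((s n : ℂ) * inner ℂ (e n) x) • u n) (T x)) := by
  obtain ⟨ι, v, m, hm⟩ := exists_hilbertBasis_eigenvectors hT
  have hin (i j : ι) : inner ℂ (T (v i)) (T (v j)) = m j * inner ℂ (v i) (v j) := by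
    rw [← ContinuousLinearMap.adjoint_inner_right, hm, inner_smul_right]
  let I : Set ι := {i | T (v i) ≠ 0}
  have hI : Countable I := by
    have := countable_of_orthonormal v.orthonormal
    infer_instance
  obtain ⟨n, hn⟩ := exists_injective_nat I
  let E : Set.range n ≃ I := (Equiv.ofInjective n hn).symm
  refine ⟨Set.range n, fun j => v (E j), fun j => (‖T (v (E j))‖⁻¹ : ℂ) • T (v (E j)),
    fun j => ‖T (v (E j))‖, ?_, ?_, fun j => norm_nonneg _, fun x => ?_⟩
  · exact v.orthonormal.comp _ (Subtype.val_injective.comp E.injective)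
  · constructor
    · intro j
      have : ‖T (v (E j))‖ ≠ 0 := norm_ne_zero_iff.2 (E j).2
      simp [norm_smul, this]
    · intro i j hij
      have : inner ℂ (v (E i)) (v (E j)) = 0 :=
        v.orthonormal.2 fun h => hij (E.injective (Subtype.ext h))
      rw [inner_smul_left, inner_smul_right, hin, this]
      simp
  · have h1 : HasSum (fun i => inner ℂ (v i) x • T (v i)) (T x) := by
      have := (v.hasSum_repr x).mapL T
      simpa [v.repr_apply_apply] using this
    have h2 : HasSum (fun i : I => inner ℂ (v i) x • T (v i)) (T x) := by
      refine (hasSum_subtype_iff_of_support_subset ?_).2 h1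
      intro i hi
      simp only [Function.mem_support, ne_eq, smul_eq_zero, not_or] at hi
      exact hi.2
    have h3 := (E.hasSum_iff).2 h2
    convert! h3 using 2 with j
    have : (‖T (v (E j))‖ : ℂ) ≠ 0 := by
      have hE : T (v (E j)) ≠ 0 := (E j).2
      simpa using hE
    simp only [Function.comp_apply]
    rw [smul_smul, mul_right_comm, mul_inv_cancel₀ this, one_mul]

end Schmidt

/-! ### Operators that intertwine two frames -/

section Frames

variable {H : Type*} [NormedAddCommGroup H] [InnerProductSpace ℂ H]
  {X : Type*} [MeasurableSpace X]

/-- The data used to measure the singular values of an operator `T` for which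
`⟨k_x, T f⟩ = φ(x) ⟨η_x, f⟩`: the vectors `k_x` of norm at most one form a continuous frame with
bounds `c` and `C`, and the vectors `η_x`, of norm one where `φ` does not vanish, are a Bessel
family with bound `C`. -/
structure FrameData (μ : Measure X) (k η : X → H) (φ : X → ℂ) (c C : ℝ≥0∞) : Prop where
  c_ne_zero : c ≠ 0
  C_ne_zero : C ≠ 0
  C_ne_top : C ≠ ⊤
  measurable_φ : Measurable φ
  measurable_k : ∀ f, Measurable fun x => inner ℂ (k x) f
  measurable_η : ∀ f, Measurable fun x => inner ℂ (η x) f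
  norm_k_le : ∀ x, ‖k x‖ ≤ 1
  norm_η_le : ∀ x, ‖η x‖ ≤ 1
  norm_η : ∀ x, φ x ≠ 0 → ‖η x‖ = 1
  lower : ∀ f, c * ‖f‖ₑ ^ 2 ≤ ∫⁻ x, ‖inner ℂ (k x) f‖ₑ ^ 2 ∂μ
  upper : ∀ f, ∫⁻ x, ‖inner ℂ (k x) f‖ₑ ^ 2 ∂μ ≤ C * ‖f‖ₑ ^ 2
  upper_η : ∀ f, ∫⁻ x, ‖inner ℂ (η x) f‖ₑ ^ 2 ∂μ ≤ C * ‖f‖ₑ ^ 2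

variable {μ : Measure X} {k η : X → H} {φ : X → ℂ} {c C : ℝ≥0∞}

lemma schmidt_apply {ι : Type*} {e u : ι → H} {s : ι → ℝ} {T : H →L[ℂ] H}
    (he : Orthonormal ℂ e)
    (hT : ∀ x : H, HasSum (fun n => ((s n : ℂ) * inner ℂ (e n) x) • u n) (T x)) (n : ι) :
    T (e n) = (s n : ℂ) • u n := by
  classical
  refine (hT (e n)).unique ?_
  have h := hasSum_single (f := fun m => ((s m : ℂ) * inner ℂ (e m) (e n)) • u m) n
    fun m hm => by simp [he.2 hm]
  simpa [inner_self_eq_norm_sq_to_K, he.1 n] using h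

lemma enorm_le_one_sq {E : Type*} [SeminormedAddCommGroup E] {x : E} (hx : ‖x‖ ≤ 1) :
    ‖x‖ₑ ^ 2 ≤ 1 := by
  refine pow_le_one' ?_ 2
  rw [← ofReal_norm]
  exact ENNReal.ofReal_le_one.2 hx

/-- Membership in `S_p` forces the multiplier `φ` into `L^p`. -/
theorem FrameData.lintegral_lt_top (D : FrameData μ k η φ c C) {T : H →L[ℂ] H}
    (hTφ : ∀ x f, inner ℂ (k x) (T f) = φ x * inner ℂ (η x) f) {p : ℝ} (hp : 0 < p)
    (hT : IsSchatten p T) : ∫⁻ x, ‖φ x‖ₑ ^ p ∂μ < ⊤ := by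
  obtain ⟨-, J, e, u, s, he, hu, hs, hsum, hsp⟩ := hT
  have hne := fun n => schmidt_apply he hsum n
  have h1 (n : J) (x : X) : φ x * inner ℂ (η x) (e n) = s n * inner ℂ (k x) (u n) := by
    rw [← hTφ, hne, inner_smul_right]
  refine (lintegral_rpow_le_tsum (A := fun x => ‖φ x‖ₑ) (s := fun n => ENNReal.ofReal (s n))
    (t := fun n x => ‖inner ℂ (η x) (e n)‖ₑ ^ 2) (b := fun n x => ‖inner ℂ (k x) (u n)‖ₑ ^ 2)
    (C := C) D.measurable_φ.enorm (fun n => (D.measurable_η _).enorm.pow_const 2)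
    (fun n => (D.measurable_k _).enorm.pow_const 2) ?_ ?_ ?_ ?_ ?_ D.C_ne_zero D.C_ne_top
    hp).trans_lt ?_
  · intro n x
    rw [← mul_pow, ← mul_pow, ← enorm_mul, h1, enorm_mul]
    congr 2
    rw [← ofReal_norm, Complex.norm_real, Real.norm_of_nonneg (hs n)]
  · intro x hx
    have hx : φ x ≠ 0 := by simpa using hx
    have h := (hsum (η x)).mapL (innerSL ℂ (k x))
    simp only [innerSL_apply_apply, inner_smul_right, hTφ, inner_self_eq_norm_sq_to_K,
      D.norm_η x hx] at h
    have h' : HasSum (fun n : J => φ x * ((‖inner ℂ (η x) (e n)‖ ^ 2 : ℝ) : ℂ)) (φ x * 1) := by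
      convert! h using 2 with n
      · rw [mul_right_comm, ← h1, mul_assoc, ← inner_conj_symm (e n), Complex.mul_conj,
          Complex.normSq_eq_norm_sq]
      · simp
    have h2 := (hasSum_mul_left_iff hx).1 h'
    have h3 : HasSum (fun n : J => ‖inner ℂ (η x) (e n)‖ ^ 2) 1 := by
      rw [← Complex.ofReal_one] at h2
      exact Complex.hasSum_ofReal.1 h2
    calc ∑' n, ‖inner ℂ (η x) (e n)‖ₑ ^ 2 = ∑' n, ENNReal.ofReal (‖inner ℂ (η x) (e n)‖ ^ 2) := by
          simp only [ENNReal.ofReal_pow (norm_nonneg _), ofReal_norm]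
      _ = 1 := by
          rw [← ENNReal.ofReal_tsum_of_nonneg (fun i => sq_nonneg _) h3.summable, h3.tsum_eq,
            ENNReal.ofReal_one]
  · exact fun x => (tsum_enorm_inner_sq_le hu (k x)).trans (enorm_le_one_sq (D.norm_k_le x))
  · exact fun n => (D.upper_η (e n)).trans (mul_le_of_le_one_right' (enorm_le_one_sq (he.1 n).le))
  · exact fun n => (D.upper (u n)).trans (mul_le_of_le_one_right' (enorm_le_one_sq (hu.1 n).le))
  · refine ENNReal.mul_lt_top D.C_ne_top.lt_top ?_
    simp only [ENNReal.ofReal_rpow_of_nonneg (hs _) hp.le]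
    rw [← ENNReal.ofReal_tsum_of_nonneg (fun n => Real.rpow_nonneg (hs n) p) hsp]
    exact ENNReal.ofReal_lt_top

/-- A compact operator whose multiplier `φ` is in `L^p` belongs to `S_p`. -/
theorem FrameData.isSchatten [CompleteSpace H] [TopologicalSpace.SeparableSpace H]
    (D : FrameData μ k η φ c C) {T : H →L[ℂ] H}
    (hTφ : ∀ x f, inner ℂ (k x) (T f) = φ x * inner ℂ (η x) f) {p : ℝ} (hp : 0 < p)
    (hT : IsCompactOperator T) (hφ : ∫⁻ x, ‖φ x‖ₑ ^ p ∂μ < ⊤) : IsSchatten p T := by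
  obtain ⟨J, e, u, s, he, hu, hs, hsum⟩ := exists_schmidt hT
  refine ⟨hT, J, e, u, s, he, hu, hs, hsum, ?_⟩
  have hne := fun n => schmidt_apply he hsum n
  have h := tsum_rpow_lt_top (A := fun x => ‖φ x‖ₑ) (s := fun n => ENNReal.ofReal (s n))
    (t := fun n x => ‖inner ℂ (η x) (e n)‖ₑ ^ 2) (b := fun n x => ‖inner ℂ (k x) (u n)‖ₑ ^ 2)
    (C := C) (c := c) D.measurable_φ.enorm (fun n => (D.measurable_η _).enorm.pow_const 2)
    (fun n => (D.measurable_k _).enorm.pow_const 2) ?_ ?_ ?_ ?_ ?_ D.c_ne_zero D.C_ne_top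
    hp hφ
  · simp only [ENNReal.ofReal_rpow_of_nonneg (hs _) hp.le] at h
    have := ENNReal.summable_toReal h.ne
    refine this.congr fun n => ?_
    rw [ENNReal.toReal_ofReal (Real.rpow_nonneg (hs n) p)]
  · intro n x
    rw [← mul_pow, ← mul_pow, ← enorm_mul, ← hTφ, hne, inner_smul_right, enorm_mul]
    congr 2
    rw [← ofReal_norm, Complex.norm_real, Real.norm_of_nonneg (hs n)]
  · exact fun x => (tsum_enorm_inner_sq_le he (η x)).trans (enorm_le_one_sq (D.norm_η_le x))
  · exact fun x => (tsum_enorm_inner_sq_le hu (k x)).trans (enorm_le_one_sq (D.norm_k_le x))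
  · exact fun n => (D.upper_η (e n)).trans (mul_le_of_le_one_right' (enorm_le_one_sq (he.1 n).le))
  · intro n
    have := D.lower (u n)
    rwa [← ofReal_norm, hu.1 n, ENNReal.ofReal_one, one_pow, mul_one] at this

end Frames

/-! ### Boundedness and compactness from integrability of the multiplier -/

section Compactness

open Filter Topology

variable {H : Type*} [NormedAddCommGroup H] [InnerProductSpace ℂ H]
  {X : Type*} [MeasurableSpace X] {μ : Measure X} {k η : X → H} {φ : X → ℂ} {c C : ℝ≥0∞}

lemma sub_sum_inner {ι : Type*} {b : ι → H} (s : Finset ι) (x y : H) :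
    inner ℂ x (y - ∑ i ∈ s, inner ℂ (b i) y • b i) =
      inner ℂ (x - ∑ i ∈ s, inner ℂ (b i) x • b i) y := by
  simp only [inner_sub_left, inner_sub_right, inner_sum, sum_inner, inner_smul_left,
    inner_smul_right, inner_conj_symm]
  congr 1
  exact Finset.sum_congr rfl fun i _ => mul_comm _ _

lemma norm_sub_sum_sq {ι : Type*} {b : ι → H} (hb : Orthonormal ℂ b) (s : Finset ι) (x : H) :
    ‖x - ∑ i ∈ s, inner ℂ (b i) x • b i‖ ^ 2 =
      ‖x‖ ^ 2 - ∑ i ∈ s, ‖inner ℂ x (b i)‖ ^ 2 := by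
  have h : inner ℂ (x - ∑ i ∈ s, inner ℂ (b i) x • b i) (x - ∑ i ∈ s, inner ℂ (b i) x • b i) =
      inner ℂ x x - ∑ i ∈ s, inner ℂ (b i) x * inner ℂ x (b i) := by
    have h0 : inner ℂ (∑ i ∈ s, inner ℂ (b i) x • b i)
        (x - ∑ i ∈ s, inner ℂ (b i) x • b i) = 0 := by
      rw [sum_inner]
      refine Finset.sum_eq_zero fun i hi => ?_
      rw [inner_smul_left, inner_sub_right, hb.inner_right_sum _ hi, sub_self, mul_zero]
    rw [inner_sub_left, h0, sub_zero, inner_sub_right, inner_sum]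
    simp only [inner_smul_right]
  have h' (i : ι) : inner ℂ (b i) x * inner ℂ x (b i) = ((‖inner ℂ x (b i)‖ ^ 2 : ℝ) : ℂ) := by
    rw [← inner_conj_symm, mul_comm, Complex.mul_conj, Complex.normSq_eq_norm_sq]
  simp only [h', inner_self_eq_norm_sq_to_K] at h
  refine Complex.ofReal_injective ?_
  push_cast at h ⊢
  exact h

/-- The quantitative form of `c ‖T f‖² ≤ ∫ |⟨k_x, T f⟩|² = ∫ |φ|² |⟨η_x, f⟩|²`, after Jensen's
inequality for the measure `|⟨η_x, f⟩|² dμ`. -/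
lemma FrameData.enorm_rpow_le (D : FrameData μ k η φ c C) {T : H →ₗ[ℂ] H}
    (hTφ : ∀ x f, inner ℂ (k x) (T f) = φ x * inner ℂ (η x) f) {q : ℝ} (hq : 2 ≤ q) (f : H) :
    c ^ (q / 2) * ‖T f‖ₑ ^ q ≤
      C ^ (q / 2 - 1) * ‖f‖ₑ ^ (q - 2) * ∫⁻ x, ‖φ x‖ₑ ^ q * ‖inner ℂ (η x) f‖ₑ ^ 2 ∂μ := by
  calc c ^ (q / 2) * ‖T f‖ₑ ^ q = (c * ‖T f‖ₑ ^ 2) ^ (q / 2) := by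
        rw [ENNReal.mul_rpow_of_nonneg _ _ (by linarith), sq_rpow_half]
    _ ≤ (∫⁻ x, ‖inner ℂ (k x) (T f)‖ₑ ^ 2 ∂μ) ^ (q / 2) :=
        ENNReal.rpow_le_rpow (D.lower _) (by linarith)
    _ = (∫⁻ x, ‖φ x‖ₑ ^ 2 * ‖inner ℂ (η x) f‖ₑ ^ 2 ∂μ) ^ (q / 2) := by
        simp only [hTφ, enorm_mul, mul_pow]
    _ ≤ (C * ‖f‖ₑ ^ 2) ^ (q / 2 - 1) *
          ∫⁻ x, (‖φ x‖ₑ ^ 2) ^ (q / 2) * ‖inner ℂ (η x) f‖ₑ ^ 2 ∂μ :=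
        rpow_lintegral_mul_le (D.measurable_φ.enorm.pow_const 2)
          ((D.measurable_η f).enorm.pow_const 2) (D.upper_η f) (by linarith)
    _ = _ := by
        simp only [sq_rpow_half]
        rw [ENNReal.mul_rpow_of_nonneg _ _ (by linarith)]
        congr 2
        rw [← sq_rpow_half _ (q - 2)]
        congr 1
        ring

/-- An operator whose multiplier is in `L^q` for some `q ≥ 2` is bounded and compact: by
`FrameData.enorm_rpow_le` and dominated convergence it is the norm limit of its compositions with
the projections onto finite sets of basis vectors. -/
theorem FrameData.exists_isCompactOperator [CompleteSpace H] [TopologicalSpace.SeparableSpace H]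
    (D : FrameData μ k η φ c C) {T : H →ₗ[ℂ] H}
    (hTφ : ∀ x f, inner ℂ (k x) (T f) = φ x * inner ℂ (η x) f) {q : ℝ} (hq : 2 ≤ q)
    (hφ : ∫⁻ x, ‖φ x‖ₑ ^ q ∂μ < ⊤) :
    ∃ T' : H →L[ℂ] H, (∀ f, T' f = T f) ∧ IsCompactOperator T' := by
  have hq0 : 0 < q := by linarith
  have hcq0 : c ^ (q / 2) ≠ 0 := by
    simp [D.c_ne_zero, ENNReal.rpow_eq_zero_iff]
    intros
    linarith
  have hCq : C ^ (q / 2 - 1) ≠ ⊤ := ENNReal.rpow_ne_top_of_nonneg (by linarith) D.C_ne_top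
  by_cases hct : c = ⊤
  · -- then `H` is trivial, since the lower bound fails for nonzero vectors
    have h0 (f : H) : f = 0 := by
      by_contra hf
      have := (D.lower f).trans (D.upper f)
      rw [hct, ENNReal.top_mul (by simpa using hf)] at this
      exact (ENNReal.mul_lt_top D.C_ne_top.lt_top
        (ENNReal.pow_lt_top enorm_lt_top)).not_ge this
    refine ⟨0, fun f => by rw [h0 f]; simp, ?_⟩
    exact isCompactOperator_zero
  have hcqt : c ^ (q / 2) ≠ ⊤ := ENNReal.rpow_ne_top_of_nonneg (by linarith) hct
  -- an estimate of `T` on `f` in terms of any bound for the integral on the right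
  have key (f : H) (M : ℝ≥0∞) (g : ℝ) (hg0 : 0 ≤ g) (hfg : ‖f‖ ≤ g)
      (hM : ∫⁻ x, ‖φ x‖ₑ ^ q * ‖inner ℂ (η x) f‖ₑ ^ 2 ∂μ ≤ M * ENNReal.ofReal g ^ 2) :
      ‖T f‖ₑ ≤ (C ^ (q / 2 - 1) / c ^ (q / 2) * M) ^ (1 / q) * ENNReal.ofReal g := by
    have h := D.enorm_rpow_le hTφ hq f
    have h2 : ‖f‖ₑ ≤ ENNReal.ofReal g := by
      rw [← ofReal_norm]
      exact ENNReal.ofReal_le_ofReal hfg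
    have h3 : ‖T f‖ₑ ^ q ≤ (C ^ (q / 2 - 1) / c ^ (q / 2) * M) * ENNReal.ofReal g ^ q := by
      calc ‖T f‖ₑ ^ q = (c ^ (q / 2) * ‖T f‖ₑ ^ q) / c ^ (q / 2) := by
            rw [mul_comm, ENNReal.mul_div_cancel_right hcq0 hcqt]
        _ ≤ (C ^ (q / 2 - 1) * ENNReal.ofReal g ^ (q - 2) * (M * ENNReal.ofReal g ^ 2)) /
              c ^ (q / 2) := by
            refine ENNReal.div_le_div_right (h.trans ?_) _
            gcongr
        _ = (C ^ (q / 2 - 1) / c ^ (q / 2) * M) *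
              (ENNReal.ofReal g ^ (q - 2) * ENNReal.ofReal g ^ 2) := by
            simp only [div_eq_mul_inv]
            ring
        _ = _ := by
            rw [← ENNReal.rpow_natCast, ← ENNReal.rpow_add_of_nonneg _ _ (by linarith) (by simp)]
            congr 2
            push_cast
            ring
    calc ‖T f‖ₑ = (‖T f‖ₑ ^ q) ^ (1 / q) := by
          rw [← ENNReal.rpow_mul, mul_one_div_cancel hq0.ne', ENNReal.rpow_one]
      _ ≤ ((C ^ (q / 2 - 1) / c ^ (q / 2) * M) * ENNReal.ofReal g ^ q) ^ (1 / q) := by gcongr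
      _ = _ := by
          rw [ENNReal.mul_rpow_of_nonneg _ _ (by positivity), ← ENNReal.rpow_mul,
            mul_one_div_cancel hq0.ne', ENNReal.rpow_one]
  have hinner (x y : H) : ‖inner ℂ x y‖ₑ ≤ ‖x‖ₑ * ‖y‖ₑ := by
    simp only [← ofReal_norm, ← ENNReal.ofReal_mul (norm_nonneg _)]
    exact ENNReal.ofReal_le_ofReal (norm_inner_le_norm _ _)
  have htop {M : ℝ≥0∞} (hM : M < ⊤) : (C ^ (q / 2 - 1) / c ^ (q / 2) * M) ^ (1 / q) ≠ ⊤ :=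
    ENNReal.rpow_ne_top_of_nonneg (by positivity)
      (ENNReal.mul_lt_top (ENNReal.div_lt_top hCq hcq0) hM).ne
  have key' {M : ℝ≥0∞} (hM : M < ⊤) {f g : H}
      (h : ‖T f‖ₑ ≤ (C ^ (q / 2 - 1) / c ^ (q / 2) * M) ^ (1 / q) * ENNReal.ofReal ‖g‖) :
      ‖T f‖ ≤ ((C ^ (q / 2 - 1) / c ^ (q / 2) * M) ^ (1 / q)).toReal * ‖g‖ := by
    have := ENNReal.toReal_mono (ENNReal.mul_lt_top (htop hM).lt_top ENNReal.ofReal_lt_top).ne h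
    simpa using this
  let T' : H →L[ℂ] H := T.mkContinuous _ fun f => key' hφ <| by
    refine key f _ ‖f‖ (norm_nonneg f) le_rfl ?_
    rw [← lintegral_mul_const _ (D.measurable_φ.enorm.pow_const q)]
    gcongr with x
    refine (hinner _ _).trans ?_
    rw [ofReal_norm]
    refine mul_le_of_le_one_left' ?_
    rw [← ofReal_norm]
    exact ENNReal.ofReal_le_one.2 (D.norm_η_le x)
  have hT' (f : H) : T' f = T f := rfl
  refine ⟨T', hT', ?_⟩
  obtain ⟨w, b, -⟩ := exists_hilbertBasis ℂ H
  have hw : Countable w := countable_of_orthonormal b.orthonormal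
  let P (s : Finset w) : H →L[ℂ] H := ∑ i ∈ s, (innerSL ℂ (b i)).smulRight (b i)
  have hP (s : Finset w) (f : H) : P s f = ∑ i ∈ s, inner ℂ (b i) f • b i := by
    simp [P]
  have hPc (s : Finset w) : IsCompactOperator (P s) := by
    refine (compactOperator (RingHom.id ℂ) H H).sum_mem (f := fun i =>
      (innerSL ℂ (b i)).smulRight (b i)) fun i _ => ?_
    exact (isCompactOperator_of_locallyCompactSpace_rng
      (ContinuousLinearMap.toSpanSingleton ℂ (b i : H))).comp_clm (innerSL ℂ (b i))
  let M (s : Finset w) : ℝ≥0∞ := ∫⁻ x, ‖φ x‖ₑ ^ q * ‖η x - P s (η x)‖ₑ ^ 2 ∂μ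
  have hη1 (s : Finset w) (x : X) : ‖η x - P s (η x)‖ₑ ^ 2 ≤ 1 := by
    refine enorm_le_one_sq ?_
    rw [← sq_le_one_iff₀ (norm_nonneg _), hP, norm_sub_sum_sq b.orthonormal]
    have h1 := D.norm_η_le x
    have h2 : 0 ≤ ∑ i ∈ s, ‖inner ℂ (η x) (b i)‖ ^ 2 := by positivity
    nlinarith [norm_nonneg (η x)]
  have hMtop (s : Finset w) : M s < ⊤ := by
    refine lt_of_le_of_lt (lintegral_mono fun x => ?_) hφ
    exact mul_le_of_le_one_right' (hη1 s x)
  have hM : Tendsto M atTop (𝓝 0) := by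
    have := tendsto_lintegral_filter_of_dominated_convergence (μ := μ) (l := atTop)
      (F := fun (s : Finset w) x => ‖φ x‖ₑ ^ q * ‖η x - P s (η x)‖ₑ ^ 2) (f := fun _ => 0)
      (fun x => ‖φ x‖ₑ ^ q) (Eventually.of_forall fun s => ?_)
      (Eventually.of_forall fun s => ae_of_all _ fun x => mul_le_of_le_one_right' (hη1 s x))
      hφ.ne (ae_of_all _ fun x => ?_)
    · simpa using this
    · have : (fun x => ‖φ x‖ₑ ^ q * ‖η x - P s (η x)‖ₑ ^ 2) = fun x =>
          ‖φ x‖ₑ ^ q * ENNReal.ofReal (1 - ∑ i ∈ s, ‖inner ℂ (η x) (b i)‖ ^ 2) := by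
        ext x
        rcases eq_or_ne (φ x) 0 with h | h
        · simp [h, hq0]
        · rw [← ofReal_norm (η x - P s (η x)), ← ENNReal.ofReal_pow (norm_nonneg _), hP,
            norm_sub_sum_sq b.orthonormal, D.norm_η x h, one_pow]
      rw [this]
      refine (D.measurable_φ.enorm.pow_const q).mul (ENNReal.measurable_ofReal.comp ?_)
      exact measurable_const.sub
        (Finset.measurable_sum _ fun i _ => (D.measurable_η _).norm.pow_const 2)
    · have h1 : Tendsto (fun s : Finset w => η x - P s (η x)) atTop (𝓝 0) := by
        have := (b.hasSum_repr (η x)).const_sub (η x)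
        simpa [hP, b.repr_apply_apply] using this
      have h2 := ((ENNReal.continuous_pow 2).tendsto _).comp h1.enorm
      have h3 := ENNReal.Tendsto.const_mul (a := ‖φ x‖ₑ ^ q) h2
        (Or.inr (ENNReal.rpow_ne_top_of_nonneg hq0.le enorm_ne_top))
      simpa using h3
  refine isCompactOperator_of_tendsto (l := atTop) (F := fun s : Finset w => T'.comp (P s)) ?_
    (Eventually.of_forall fun s => (hPc s).clm_comp T')
  rw [tendsto_iff_norm_sub_tendsto_zero]
  have hlim : Tendsto (fun s => ((C ^ (q / 2 - 1) / c ^ (q / 2) * M s) ^ (1 / q)).toReal) atTop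
      (𝓝 0) := by
    have h1 := ENNReal.Tendsto.const_mul (a := C ^ (q / 2 - 1) / c ^ (q / 2)) hM
      (Or.inr (ENNReal.div_lt_top hCq hcq0).ne)
    have h2 := ((ENNReal.continuous_rpow_const (y := 1 / q)).tendsto _).comp h1
    have h3 := (ENNReal.tendsto_toReal (a := (C ^ (q / 2 - 1) / c ^ (q / 2) * 0) ^ (1 / q))
      (by simp [hq0])).comp h2
    simpa [hq0, Function.comp_def] using h3
  refine squeeze_zero (fun _ => norm_nonneg _) (fun s => ?_) hlim
  refine ContinuousLinearMap.opNorm_le_bound _ ENNReal.toReal_nonneg fun f => ?_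
  have h1 : (T'.comp (P s) - T') f = - T (f - P s f) := by
    simp [hT']
  rw [h1, norm_neg]
  refine key' (hMtop s) (key _ _ _ (norm_nonneg f) ?_ ?_)
  · rw [← sq_le_sq₀ (norm_nonneg _) (norm_nonneg _), hP, norm_sub_sum_sq b.orthonormal]
    have h2 : 0 ≤ ∑ i ∈ s, ‖inner ℂ f (b i)‖ ^ 2 := by positivity
    linarith
  · rw [← lintegral_mul_const' _ _ (by simp)]
    refine lintegral_mono fun x => ?_
    rw [mul_assoc, ← mul_pow, ofReal_norm, hP, hP, sub_sum_inner]
    gcongr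
    exact hinner _ _

end Compactness

/-! ### Taylor coefficients and circle averages of entire functions -/

section Radial

open Real (circleAverage)

/-- The `n`-th Taylor coefficient at the origin. -/
def taylorCoeff (F : ℂ → ℂ) (n : ℕ) : ℂ := (n.factorial : ℂ)⁻¹ * iteratedDeriv n F 0

lemma hasSum_taylorCoeff {F : ℂ → ℂ} (hF : Differentiable ℂ F) (z : ℂ) :
    HasSum (fun n => taylorCoeff F n * z ^ n) (F z) := by
  convert! Complex.hasSum_taylorSeries_of_entire hF 0 z using 2 with n
  simp only [taylorCoeff, smul_eq_mul, sub_zero]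
  ring

lemma taylorCoeff_zero (F : ℂ → ℂ) : taylorCoeff F 0 = F 0 := by
  simp [taylorCoeff]

lemma taylorCoeff_deriv (F : ℂ → ℂ) (n : ℕ) :
    taylorCoeff (deriv F) n = (n + 1) * taylorCoeff F (n + 1) := by
  have : (n + 1 : ℂ) ≠ 0 := by exact_mod_cast n.succ_ne_zero
  rw [taylorCoeff, taylorCoeff, iteratedDeriv_succ', Nat.factorial_succ]
  push_cast
  field_simp

lemma integral_exp_int_mul_I (k : ℤ) :
    ∫ θ in (0 : ℝ)..(2 * Real.pi), Complex.exp (k * θ * Complex.I) =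
      if k = 0 then 2 * Real.pi else 0 := by
  split_ifs with hk
  · simp [hk]
  · have hc : (k * Complex.I : ℂ) ≠ 0 := by simp [hk]
    have := integral_exp_mul_complex (a := 0) (b := 2 * Real.pi) hc
    simp only [mul_right_comm _ Complex.I] at this
    rw [this, Complex.ofReal_zero, mul_zero, zero_mul, Complex.exp_zero]
    rw [show (k * ((2 * Real.pi : ℝ) : ℂ) * Complex.I : ℂ) = k * (2 * Real.pi * Complex.I) by
      push_cast; ring, Complex.exp_int_mul_two_pi_mul_I, sub_self, zero_div]

/-- Parseval's formula on a circle. -/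
lemma hasSum_circleAverage_norm_sq {F : ℂ → ℂ} (hF : Differentiable ℂ F) (r : ℝ) :
    HasSum (fun n => ‖taylorCoeff F n‖ ^ 2 * r ^ (2 * n))
      (circleAverage (fun z => ‖F z‖ ^ 2) 0 r) := by
  set a := taylorCoeff F with ha
  have hsum : Summable fun n => ‖a n‖ * |r| ^ n := by
    have := (hasSum_taylorCoeff hF r).summable.norm
    simpa using this
  let t (x : ℕ × ℕ) (θ : ℝ) : ℂ :=
    (a x.1 * r ^ x.1) * (starRingEnd ℂ) (a x.2 * r ^ x.2) *
      Complex.exp (((x.1 - x.2 : ℤ) : ℂ) * θ * Complex.I)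
  have hpt (θ : ℝ) : HasSum (fun x => t x θ) ((‖F (circleMap 0 r θ)‖ ^ 2 : ℝ) : ℂ) := by
    have h1 := hasSum_taylorCoeff hF (circleMap 0 r θ)
    have h2 := h1.mapL Complex.conjCLE.toContinuousLinearMap
    simp only [ContinuousLinearEquiv.coe_coe, Complex.conjCLE_apply] at h2
    have h3 := h1.mul h2 (summable_mul_of_summable_norm
      (f := fun n => a n * circleMap 0 r θ ^ n)
      (g := fun n => (starRingEnd ℂ) (a n * circleMap 0 r θ ^ n))
      h1.summable.norm h2.summable.norm)
    convert! h3 using 1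
    · ext x
      simp only [t, map_mul, map_pow, circleMap, zero_add, ← Complex.exp_conj, mul_pow,
        Complex.conj_ofReal, Complex.conj_I, map_natCast, ← Complex.exp_nat_mul, ha]
      rw [show (((x.1 - x.2 : ℤ) : ℂ) * θ * Complex.I) =
        x.1 * (θ * Complex.I) + x.2 * (θ * -Complex.I) by push_cast; ring, Complex.exp_add]
      ring
    · rw [Complex.mul_conj, Complex.normSq_eq_norm_sq]
  have hnorm (x : ℕ × ℕ) (θ : ℝ) : ‖t x θ‖ = (‖a x.1‖ * |r| ^ x.1) * (‖a x.2‖ * |r| ^ x.2) := by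
    have : ‖Complex.exp (((x.1 - x.2 : ℤ) : ℂ) * θ * Complex.I)‖ = 1 := by
      rw [show (((x.1 - x.2 : ℤ) : ℂ) * θ * Complex.I) =
        (((x.1 - x.2 : ℤ) * θ : ℝ) : ℂ) * Complex.I by push_cast; ring]
      exact Complex.norm_exp_ofReal_mul_I _
    simp only [t, norm_mul, this, RCLike.norm_conj, norm_pow, Complex.norm_real, mul_one,
      Real.norm_eq_abs]
  have hint := intervalIntegral.hasSum_integral_of_dominated_convergence
    (μ := volume) (a := 0) (b := 2 * Real.pi) (F := t)
    (f := fun θ => ((‖F (circleMap 0 r θ)‖ ^ 2 : ℝ) : ℂ))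
    (fun x _ => (‖a x.1‖ * |r| ^ x.1) * (‖a x.2‖ * |r| ^ x.2))
    (fun x => (by fun_prop : Continuous (t x)).aestronglyMeasurable)
    (fun x => Filter.Eventually.of_forall fun θ _ => (hnorm x θ).le)
    (Filter.Eventually.of_forall fun θ _ =>
      hsum.mul_of_nonneg hsum (fun _ => by positivity) (fun _ => by positivity))
    (by simp) (Filter.Eventually.of_forall fun θ _ => hpt θ)
  have hdiag : HasSum (fun n => ((‖a n‖ ^ 2 * r ^ (2 * n) * (2 * Real.pi) : ℝ) : ℂ))
      (∫ θ in (0 : ℝ)..2 * Real.pi, ((‖F (circleMap 0 r θ)‖ ^ 2 : ℝ) : ℂ)) := by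
    have hinj : Function.Injective fun n : ℕ => (n, n) := fun m n h => (Prod.mk.inj h).1
    convert! (hinj.hasSum_iff ?_).2 hint using 2 with n
    · simp only [Function.comp_apply, t, intervalIntegral.integral_const_mul,
        integral_exp_int_mul_I, sub_self, if_true, Complex.mul_conj, Complex.normSq_eq_norm_sq,
        norm_mul, norm_pow, Complex.norm_real, Real.norm_eq_abs, mul_pow, pow_mul]
      push_cast
      have : ((|r| : ℝ) : ℂ) ^ 2 = (r : ℂ) ^ 2 := by exact_mod_cast sq_abs r
      rw [← this]
      ring
    · intro x hx
      have : (x.1 - x.2 : ℤ) ≠ 0 := by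
        intro h
        exact hx ⟨x.1, Prod.ext rfl (by simpa using sub_eq_zero.1 h)⟩
      simp only [t, intervalIntegral.integral_const_mul, integral_exp_int_mul_I, this, if_false,
        mul_zero, Complex.ofReal_zero]
  rw [intervalIntegral.integral_ofReal, Complex.hasSum_ofReal] at hdiag
  have := hdiag.mul_left (2 * Real.pi)⁻¹
  rw [Real.circleAverage_def, smul_eq_mul]
  convert! this using 2 with n
  field_simp [Real.pi_ne_zero]

/-- Integration in polar coordinates. -/
lemma lintegral_mul_radial {f : ℂ → ℝ} (hf : Continuous f) (hf0 : ∀ z, 0 ≤ f z) {ω : ℝ → ℝ≥0∞}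
    (hω : Measurable ω) :
    ∫⁻ z, ENNReal.ofReal (f z) * ω ‖z‖ = ∫⁻ r in Set.Ioi (0 : ℝ),
      ENNReal.ofReal (2 * Real.pi * circleAverage f 0 r) * (ENNReal.ofReal r * ω r) := by
  have hm : Measurable fun p : ℝ × ℝ => ENNReal.ofReal p.1 *
      (ENNReal.ofReal (f (circleMap 0 p.1 p.2)) * ω |p.1|) := by
    have : Continuous fun p : ℝ × ℝ => f (circleMap 0 p.1 p.2) := by
      refine hf.comp ?_
      simp only [circleMap]
      fun_prop
    exact (ENNReal.measurable_ofReal.comp measurable_fst).mul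
      ((ENNReal.measurable_ofReal.comp this.measurable).mul
        (hω.comp (continuous_abs.measurable.comp measurable_fst)))
  have hpol (p : ℝ × ℝ) : Complex.polarCoord.symm p = circleMap 0 p.1 p.2 := by
    simp [circleMap, Complex.exp_mul_I]
  rw [← Complex.lintegral_comp_polarCoord_symm, polarCoord_target, Measure.volume_eq_prod,
    ← Measure.prod_restrict]
  simp only [smul_eq_mul, hpol, norm_circleMap_zero]
  rw [lintegral_prod _ hm.aemeasurable]
  refine setLIntegral_congr_fun measurableSet_Ioi fun r hr => ?_
  have hr : 0 < r := hr
  have hc : Continuous fun θ => f (circleMap 0 r θ) := hf.comp (continuous_circleMap 0 r)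
  have h1 : ∫⁻ θ in Set.Ioo (-Real.pi) Real.pi, ENNReal.ofReal (f (circleMap 0 r θ)) =
      ENNReal.ofReal (2 * Real.pi * circleAverage f 0 r) := by
    rw [restrict_Ioo_eq_restrict_Ioc, ← ofReal_integral_eq_lintegral_ofReal
      (hc.integrableOn_Ioc) (Filter.Eventually.of_forall fun θ => hf0 _),
      ← intervalIntegral.integral_of_le (by linarith [Real.pi_pos]), Real.circleAverage_def,
      smul_eq_mul, mul_inv_cancel_left₀ (by positivity)]
    congr 1
    have hper : Function.Periodic (fun θ => f (circleMap 0 r θ)) (2 * Real.pi) :=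
      (periodic_circleMap 0 r).comp f
    have := hper.intervalIntegral_add_eq (-Real.pi) 0
    rw [zero_add, show -Real.pi + 2 * Real.pi = Real.pi by ring] at this
    exact this
  simp only
  rw [lintegral_const_mul _ (by fun_prop), lintegral_mul_const _ (by fun_prop), h1, abs_of_pos hr]
  ring

/-- The integral of `|F|²` against a radial weight, in terms of Taylor coefficients. -/
lemma lintegral_enorm_sq_mul_radial {F : ℂ → ℂ} (hF : Differentiable ℂ F) {ω : ℝ → ℝ≥0∞}
    (hω : Measurable ω) :
    ∫⁻ z, ‖F z‖ₑ ^ 2 * ω ‖z‖ =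
      ∑' n, ‖taylorCoeff F n‖ₑ ^ 2 * ∫⁻ z : ℂ, ENNReal.ofReal (‖z‖ ^ (2 * n)) * ω ‖z‖ := by
  have h1 : ∫⁻ z, ‖F z‖ₑ ^ 2 * ω ‖z‖ = ∫⁻ z, ENNReal.ofReal (‖F z‖ ^ 2) * ω ‖z‖ := by
    simp only [ENNReal.ofReal_pow (norm_nonneg _), ofReal_norm]
  have h2 (n : ℕ) (r : ℝ) (hr : 0 < r) :
      circleAverage (fun z : ℂ => ‖z‖ ^ (2 * n)) 0 r = r ^ (2 * n) := by
    refine Real.circleAverage_const_on_circle fun z hz => ?_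
    rw [mem_sphere_zero_iff_norm, abs_of_pos hr] at hz
    rw [hz]
  rw [h1, lintegral_mul_radial (f := fun z => ‖F z‖ ^ 2)
    (hF.continuous.norm.pow 2) (fun _ => by positivity) hω]
  have h3 : ∀ n, ‖taylorCoeff F n‖ₑ ^ 2 * ∫⁻ z : ℂ, ENNReal.ofReal (‖z‖ ^ (2 * n)) * ω ‖z‖ =
      ∫⁻ r in Set.Ioi (0 : ℝ), ENNReal.ofReal (2 * Real.pi * (‖taylorCoeff F n‖ ^ 2 *
        r ^ (2 * n))) * (ENNReal.ofReal r * ω r) := by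
    intro n
    rw [lintegral_mul_radial (by fun_prop) (fun _ => by positivity) hω,
      ← lintegral_const_mul' _ _ (by simp)]
    refine setLIntegral_congr_fun measurableSet_Ioi fun r hr => ?_
    rw [h2 n r hr, ← mul_assoc, ← ofReal_norm, ← ENNReal.ofReal_pow (norm_nonneg _),
      ← ENNReal.ofReal_mul (by positivity)]
    congr 2
    ring
  simp only [h3]
  rw [← lintegral_tsum fun n => (by fun_prop)]
  refine setLIntegral_congr_fun measurableSet_Ioi fun r hr => ?_
  have hr : 0 < r := hr
  have h4 := (hasSum_circleAverage_norm_sq hF r).mul_left (2 * Real.pi)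
  rw [ENNReal.tsum_mul_right, ← h4.tsum_eq,
    ENNReal.ofReal_tsum_of_nonneg (fun n => by positivity) h4.summable]

end Radial

/-! ### Gaussian moments and the norm of the Fock space -/

section Moments

variable {α : ℝ}

lemma integral_moment (hα : 0 < α) (n : ℕ) :
    ∫ z : ℂ, ‖z‖ ^ (2 * n) * Real.exp (-α * ‖z‖ ^ 2) =
      Real.pi * n.factorial / α ^ (n + 1) := by
  have h := Complex.integral_rpow_mul_exp_neg_mul_rpow (p := 2) (q := 2 * n) (b := α)
    (by norm_num) (by have : (0 : ℝ) ≤ n := n.cast_nonneg; linarith) hα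
  have h1 : (2 * (n : ℝ) + 2) / 2 = n + 1 := by ring
  have h2 : -(2 * (n : ℝ) + 2) / 2 = -((n + 1 : ℕ) : ℝ) := by push_cast; ring
  rw [h1, h2, Real.Gamma_nat_eq_factorial, Real.rpow_neg hα.le, Real.rpow_natCast] at h
  have h3 : ∀ z : ℂ, ‖z‖ ^ (2 * (n : ℝ)) * Real.exp (-α * ‖z‖ ^ (2 : ℝ)) =
      ‖z‖ ^ (2 * n) * Real.exp (-α * ‖z‖ ^ 2) := by
    intro z
    rw [Real.rpow_two, ← Real.rpow_natCast _ (2 * n)]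
    push_cast
    rfl
  simp only [h3] at h
  rw [h]
  field_simp

lemma integrable_moment (hα : 0 < α) (n : ℕ) :
    Integrable fun z : ℂ => ‖z‖ ^ (2 * n) * Real.exp (-α * ‖z‖ ^ 2) := by
  refine Integrable.of_integral_ne_zero ?_
  rw [integral_moment hα]
  positivity

lemma lintegral_moment (hα : 0 < α) (n : ℕ) :
    ∫⁻ z : ℂ, ENNReal.ofReal (‖z‖ ^ (2 * n) * Real.exp (-α * ‖z‖ ^ 2)) =
      ENNReal.ofReal (Real.pi * n.factorial / α ^ (n + 1)) := by
  rw [← ofReal_integral_eq_lintegral_ofReal (integrable_moment hα n)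
    (Filter.Eventually.of_forall fun z => by positivity), integral_moment hα]

lemma lintegral_gaussianMeasure (α : ℝ) (f : ℂ → ℝ≥0∞) (hf : Measurable f) :
    ∫⁻ z, f z ∂gaussianMeasure α =
      ∫⁻ z, f z * ENNReal.ofReal (α / Real.pi * Real.exp (-α * ‖z‖ ^ 2)) := by
  rw [gaussianMeasure, lintegral_withDensity_eq_lintegral_mul _ (by fun_prop) hf]
  simp only [Pi.mul_apply, mul_comm]

lemma lintegral_enorm_sq_gaussianMeasure (hα : 0 < α) {F : ℂ → ℂ} (hF : Differentiable ℂ F) :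
    ∫⁻ z, ‖F z‖ₑ ^ 2 ∂gaussianMeasure α =
      ∑' n, ‖taylorCoeff F n‖ₑ ^ 2 * ENNReal.ofReal (n.factorial / α ^ n) := by
  rw [lintegral_gaussianMeasure _ _ (hF.continuous.enorm.measurable.pow_const 2),
    lintegral_enorm_sq_mul_radial hF
      (ω := fun r => ENNReal.ofReal (α / Real.pi * Real.exp (-α * r ^ 2))) (by fun_prop)]
  congr 1 with n
  congr 1
  calc ∫⁻ z : ℂ, ENNReal.ofReal (‖z‖ ^ (2 * n)) *
        ENNReal.ofReal (α / Real.pi * Real.exp (-α * ‖z‖ ^ 2))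
      = ∫⁻ z : ℂ, ENNReal.ofReal (α / Real.pi) *
          ENNReal.ofReal (‖z‖ ^ (2 * n) * Real.exp (-α * ‖z‖ ^ 2)) := by
        refine lintegral_congr fun z => ?_
        rw [← ENNReal.ofReal_mul (by positivity), ← ENNReal.ofReal_mul (by positivity)]
        congr 1
        ring
    _ = _ := by
        rw [lintegral_const_mul _ (by fun_prop), lintegral_moment hα,
          ← ENNReal.ofReal_mul (by positivity)]
        congr 1
        field_simp [Real.pi_ne_zero]
        ring

/-- The squared norm `∂_z ∂_{\bar z} e^{α|z|²}`, at `|z| = r`, of the functional `f ↦ f'(z)` on the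
Fock space. -/
def derivNormSq (α r : ℝ) : ℝ := α * (1 + α * r ^ 2) * Real.exp (α * r ^ 2)

lemma derivNormSq_pos (hα : 0 < α) (r : ℝ) : 0 < derivNormSq α r := by
  unfold derivNormSq
  positivity

@[fun_prop]
lemma continuous_derivNormSq (α : ℝ) : Continuous (derivNormSq α) := by
  unfold derivNormSq
  fun_prop

lemma inv_derivNormSq (α r : ℝ) :
    (derivNormSq α r)⁻¹ = (α * (1 + α * r ^ 2))⁻¹ * Real.exp (-α * r ^ 2) := by
  rw [derivNormSq, mul_inv, ← Real.exp_neg, neg_mul]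

lemma lintegral_derivWeight_le (hα : 0 < α) (n : ℕ) :
    ENNReal.ofReal ((n + 1) ^ 2) *
        ∫⁻ z : ℂ, ENNReal.ofReal (‖z‖ ^ (2 * n)) * ENNReal.ofReal ((derivNormSq α ‖z‖)⁻¹) ≤
      ENNReal.ofReal (2 * Real.pi / α) * ENNReal.ofReal ((n + 1).factorial / α ^ (n + 1)) := by
  -- bound the weight by the Gaussian times `α⁻¹` for `n = 0` and `(α |z|)⁻²` for `n ≥ 1`
  rcases n with _ | n
  · calc _ ≤ ENNReal.ofReal (((0 : ℕ) + 1) ^ 2) * ∫⁻ z : ℂ, ENNReal.ofReal α⁻¹ *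
          ENNReal.ofReal (‖z‖ ^ (2 * 0) * Real.exp (-α * ‖z‖ ^ 2)) := by
          refine mul_le_mul' le_rfl (lintegral_mono fun z => ?_)
          rw [← ENNReal.ofReal_mul (by positivity), ← ENNReal.ofReal_mul (by positivity),
            inv_derivNormSq]
          refine ENNReal.ofReal_le_ofReal ?_
          have : (α * (1 + α * ‖z‖ ^ 2))⁻¹ ≤ α⁻¹ := by
            refine inv_anti₀ hα ?_
            nlinarith [mul_nonneg hα.le (sq_nonneg ‖z‖)]
          have h0 := Real.exp_pos (-α * ‖z‖ ^ 2)
          simp only [mul_zero, pow_zero, one_mul]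
          gcongr
      _ ≤ _ := by
          rw [lintegral_const_mul _ (by fun_prop), lintegral_moment hα,
            ← ENNReal.ofReal_mul (by positivity), ← ENNReal.ofReal_mul (by positivity),
            ← ENNReal.ofReal_mul (by positivity)]
          refine ENNReal.ofReal_le_ofReal ?_
          simp
          have : 0 ≤ Real.pi / α * α⁻¹ := by positivity
          calc α⁻¹ * (Real.pi / α) = Real.pi / α * α⁻¹ := mul_comm _ _
            _ ≤ 2 * (Real.pi / α * α⁻¹) := by linarith
            _ = _ := by ring
  · calc _ ≤ ENNReal.ofReal (((n + 1 : ℕ) + 1) ^ 2) * ∫⁻ z : ℂ, ENNReal.ofReal (α ^ 2)⁻¹ *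
          ENNReal.ofReal (‖z‖ ^ (2 * n) * Real.exp (-α * ‖z‖ ^ 2)) := by
          refine mul_le_mul' le_rfl (lintegral_mono fun z => ?_)
          rw [← ENNReal.ofReal_mul (by positivity), ← ENNReal.ofReal_mul (by positivity),
            inv_derivNormSq]
          refine ENNReal.ofReal_le_ofReal ?_
          have : ‖z‖ ^ 2 * (α * (1 + α * ‖z‖ ^ 2))⁻¹ ≤ (α ^ 2)⁻¹ := by
            rw [← div_eq_mul_inv, div_le_iff₀ (by positivity)]
            field_simp
            linarith
          calc ‖z‖ ^ (2 * (n + 1)) * ((α * (1 + α * ‖z‖ ^ 2))⁻¹ * Real.exp (-α * ‖z‖ ^ 2))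
              = (‖z‖ ^ 2 * (α * (1 + α * ‖z‖ ^ 2))⁻¹) *
                  (‖z‖ ^ (2 * n) * Real.exp (-α * ‖z‖ ^ 2)) := by ring
            _ ≤ _ := by gcongr
      _ ≤ _ := by
          rw [lintegral_const_mul _ (by fun_prop), lintegral_moment hα,
            ← ENNReal.ofReal_mul (by positivity), ← ENNReal.ofReal_mul (by positivity),
            ← ENNReal.ofReal_mul (by positivity)]
          refine ENNReal.ofReal_le_ofReal ?_
          rw [Nat.factorial_succ, Nat.factorial_succ]
          push_cast
          have h : (n + 2 : ℝ) ≤ 2 * (n + 1) := by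
            have : (0 : ℝ) ≤ n := n.cast_nonneg
            linarith
          calc ((n : ℝ) + 1 + 1) ^ 2 * ((α ^ 2)⁻¹ * (Real.pi * n.factorial / α ^ (n + 1)))
              = (n + 2) * ((n + 2) * (Real.pi * n.factorial / (α * α ^ (n + 1 + 1)))) := by
                field_simp
                ring
            _ ≤ (2 * (n + 1)) * ((n + 2) * (Real.pi * n.factorial / (α * α ^ (n + 1 + 1)))) := by
                gcongr
            _ = _ := by
                field_simp
                ring

lemma le_lintegral_derivWeight (hα : 0 < α) (n : ℕ) :
    ENNReal.ofReal (Real.pi / (2 * α)) * ENNReal.ofReal ((n + 1).factorial / α ^ (n + 1)) ≤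
      ENNReal.ofReal ((n + 1) ^ 2) *
        ∫⁻ z : ℂ, ENNReal.ofReal (‖z‖ ^ (2 * n)) * ENNReal.ofReal ((derivNormSq α ‖z‖)⁻¹) := by
  -- the convex function `t ↦ 1 / (1 + t)` lies above its tangent at the mean value `t = n + 1`
  -- of `α |z|²` with respect to the measure `|z|^{2n} e^{-α|z|²} dm`
  let f : ℂ → ℝ := fun z => α⁻¹ * (2 / (n + 2) - 1 / (n + 2) ^ 2) *
      (‖z‖ ^ (2 * n) * Real.exp (-α * ‖z‖ ^ 2)) -
        1 / (n + 2) ^ 2 * (‖z‖ ^ (2 * (n + 1)) * Real.exp (-α * ‖z‖ ^ 2))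
  have hf1 : Integrable f :=
    ((integrable_moment hα n).const_mul _).sub ((integrable_moment hα (n + 1)).const_mul _)
  have hf2 : ∫ z, f z = Real.pi * n.factorial / α ^ (n + 1) / (α * (n + 2)) := by
    rw [integral_sub ((integrable_moment hα n).const_mul _)
      ((integrable_moment hα (n + 1)).const_mul _), integral_const_mul, integral_const_mul,
      integral_moment hα, integral_moment hα, Nat.factorial_succ]
    push_cast
    field_simp
    ring
  have hle (z : ℂ) : f z ≤ ‖z‖ ^ (2 * n) * (derivNormSq α ‖z‖)⁻¹ := by
    rw [inv_derivNormSq]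
    have h : 2 / (n + 2) - (1 + α * ‖z‖ ^ 2) / (n + 2 : ℝ) ^ 2 ≤ (1 + α * ‖z‖ ^ 2)⁻¹ := by
      have h1 : 0 < 1 + α * ‖z‖ ^ 2 := by positivity
      generalize 1 + α * ‖z‖ ^ 2 = t at h1
      have h2 : (0 : ℝ) < n + 2 := by positivity
      generalize (n + 2 : ℝ) = m at h2
      rw [← sub_nonneg]
      have : t⁻¹ - (2 / m - t / m ^ 2) = (t - m) ^ 2 / (t * m ^ 2) := by
        field_simp
        ring
      rw [this]
      positivity
    calc f z = (‖z‖ ^ (2 * n) * (α⁻¹ * Real.exp (-α * ‖z‖ ^ 2))) *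
          (2 / (n + 2) - (1 + α * ‖z‖ ^ 2) / (n + 2 : ℝ) ^ 2) := by
          simp only [f]
          field_simp
          ring
      _ ≤ (‖z‖ ^ (2 * n) * (α⁻¹ * Real.exp (-α * ‖z‖ ^ 2))) * (1 + α * ‖z‖ ^ 2)⁻¹ := by gcongr
      _ = _ := by rw [mul_inv]; ring
  calc ENNReal.ofReal (Real.pi / (2 * α)) * ENNReal.ofReal ((n + 1).factorial / α ^ (n + 1))
      ≤ ENNReal.ofReal ((n + 1) ^ 2) * ENNReal.ofReal (∫ z, f z) := by
        rw [← ENNReal.ofReal_mul (by positivity), ← ENNReal.ofReal_mul (by positivity), hf2]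
        refine ENNReal.ofReal_le_ofReal ?_
        rw [Nat.factorial_succ]
        push_cast
        have h : (n + 2 : ℝ) ≤ 2 * (n + 1) := by
          have : (0 : ℝ) ≤ n := n.cast_nonneg
          linarith
        calc Real.pi / (2 * α) * ((n + 1) * n.factorial / α ^ (n + 1))
            = Real.pi * n.factorial * (n + 1) ^ 2 / (α * α ^ (n + 1) * (2 * (n + 1))) := by
              field_simp
          _ ≤ Real.pi * n.factorial * (n + 1) ^ 2 / (α * α ^ (n + 1) * (n + 2)) := by gcongr
          _ = _ := by field_simp
    _ ≤ ENNReal.ofReal ((n + 1) ^ 2) * ∫⁻ z, ENNReal.ofReal (f z) := by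
        gcongr
        rw [integral_eq_lintegral_pos_part_sub_lintegral_neg_part hf1]
        exact (ENNReal.ofReal_le_ofReal (sub_le_self _ ENNReal.toReal_nonneg)).trans
          ENNReal.ofReal_toReal_le
    _ ≤ _ := by
        gcongr with z
        rw [← ENNReal.ofReal_mul (by positivity)]
        exact ENNReal.ofReal_le_ofReal (hle z)

lemma lintegral_deriv_sq (α : ℝ) {F : ℂ → ℂ} (hF : Differentiable ℂ F) :
    ∫⁻ z, ‖deriv F z‖ₑ ^ 2 * ENNReal.ofReal ((derivNormSq α ‖z‖)⁻¹) =
      ∑' n, ‖taylorCoeff F (n + 1)‖ₑ ^ 2 * (ENNReal.ofReal ((n + 1) ^ 2) *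
        ∫⁻ z : ℂ, ENNReal.ofReal (‖z‖ ^ (2 * n)) * ENNReal.ofReal ((derivNormSq α ‖z‖)⁻¹)) := by
  have hω : Measurable fun r => ENNReal.ofReal ((derivNormSq α r)⁻¹) :=
    ENNReal.measurable_ofReal.comp (continuous_derivNormSq α).measurable.inv
  rw [lintegral_enorm_sq_mul_radial hF.deriv hω]
  congr 1 with n
  rw [taylorCoeff_deriv, enorm_mul, mul_pow, mul_assoc, mul_left_comm]
  congr 2
  rw [← ofReal_norm, ← ENNReal.ofReal_pow (norm_nonneg _)]
  congr 2
  exact_mod_cast Complex.norm_natCast (n + 1)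

/-- The upper frame bound for derivatives. -/
lemma lintegral_deriv_sq_le (hα : 0 < α) {F : ℂ → ℂ} (hF : Differentiable ℂ F) :
    ∫⁻ z, ‖deriv F z‖ₑ ^ 2 * ENNReal.ofReal ((derivNormSq α ‖z‖)⁻¹) ≤
      ENNReal.ofReal (2 * Real.pi / α) * ∑' n, ‖taylorCoeff F (n + 1)‖ₑ ^ 2 *
        ENNReal.ofReal ((n + 1).factorial / α ^ (n + 1)) := by
  rw [lintegral_deriv_sq α hF, ← ENNReal.tsum_mul_left]
  refine ENNReal.tsum_le_tsum fun n => ?_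
  rw [mul_left_comm (ENNReal.ofReal (2 * Real.pi / α))]
  exact mul_le_mul' le_rfl (lintegral_derivWeight_le hα n)

/-- The lower frame bound for derivatives. -/
lemma le_lintegral_deriv_sq (hα : 0 < α) {F : ℂ → ℂ} (hF : Differentiable ℂ F) :
    ENNReal.ofReal (Real.pi / (2 * α)) * ∑' n, ‖taylorCoeff F (n + 1)‖ₑ ^ 2 *
        ENNReal.ofReal ((n + 1).factorial / α ^ (n + 1)) ≤
      ∫⁻ z, ‖deriv F z‖ₑ ^ 2 * ENNReal.ofReal ((derivNormSq α ‖z‖)⁻¹) := by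
  rw [lintegral_deriv_sq α hF, ← ENNReal.tsum_mul_left]
  refine ENNReal.tsum_le_tsum fun n => ?_
  rw [mul_left_comm (ENNReal.ofReal (Real.pi / (2 * α)))]
  exact mul_le_mul' le_rfl (le_lintegral_derivWeight hα n)

end Moments

/-! ### The Fock space as a Hilbert space of entire functions -/

section Fock

variable {α : ℝ}

lemma ae_gaussianMeasure_iff (hα : 0 < α) {F G : ℂ → ℂ} (hF : Continuous F) (hG : Continuous G) :
    F =ᵐ[gaussianMeasure α] G ↔ F = G := by
  refine ⟨fun h => ?_, fun h => by rw [h]⟩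
  refine (Continuous.ae_eq_iff_eq volume hF hG).1 ?_
  refine (withDensity_absolutelyContinuous' (by fun_prop) ?_).ae_eq h
  refine Filter.Eventually.of_forall fun z => ?_
  simp only [ne_eq, ENNReal.ofReal_eq_zero, not_le]
  positivity

/-- The entire function represented by an element of the Fock space. -/
def entireRep (f : FockSpace α) : ℂ → ℂ := f.2.choose

lemma differentiable_entireRep (f : FockSpace α) : Differentiable ℂ (entireRep f) :=
  f.2.choose_spec.1

lemma coe_ae_eq_entireRep (f : FockSpace α) :
    (f : Lp ℂ 2 (gaussianMeasure α)) =ᵐ[gaussianMeasure α] entireRep f :=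
  f.2.choose_spec.2

lemma entireRep_eq (hα : 0 < α) {f : FockSpace α} {F : ℂ → ℂ} (hF : Differentiable ℂ F)
    (h : (f : Lp ℂ 2 (gaussianMeasure α)) =ᵐ[gaussianMeasure α] F) : entireRep f = F :=
  (ae_gaussianMeasure_iff hα (differentiable_entireRep f).continuous hF.continuous).1
    ((coe_ae_eq_entireRep f).symm.trans h)

lemma entireRep_add (hα : 0 < α) (f h : FockSpace α) :
    entireRep (f + h) = entireRep f + entireRep h :=
  entireRep_eq hα ((differentiable_entireRep f).add (differentiable_entireRep h))
    ((Lp.coeFn_add _ _).trans ((coe_ae_eq_entireRep f).add (coe_ae_eq_entireRep h)))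

lemma entireRep_smul (hα : 0 < α) (c : ℂ) (f : FockSpace α) :
    entireRep (c • f) = c • entireRep f :=
  entireRep_eq hα ((differentiable_entireRep f).const_smul c)
    ((Lp.coeFn_smul _ _).trans ((coe_ae_eq_entireRep f).const_smul c))

lemma enorm_sq_eq_lintegral (f : FockSpace α) :
    ‖f‖ₑ ^ 2 = ∫⁻ z, ‖entireRep f z‖ₑ ^ 2 ∂gaussianMeasure α := by
  have h1 : ‖f‖ₑ = eLpNorm (entireRep f) 2 (gaussianMeasure α) := by
    rw [← eLpNorm_congr_ae (coe_ae_eq_entireRep f)]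
    exact Lp.enorm_def _
  have h2 := eLpNorm_nnreal_pow_eq_lintegral (μ := gaussianMeasure α) (f := entireRep f) (p := 2)
    two_ne_zero
  rw [h1]
  simpa using h2

lemma enorm_sq_eq_tsum (hα : 0 < α) (f : FockSpace α) :
    ‖f‖ₑ ^ 2 = ∑' n, ‖taylorCoeff (entireRep f) n‖ₑ ^ 2 * ENNReal.ofReal (n.factorial / α ^ n) := by
  rw [enorm_sq_eq_lintegral, lintegral_enorm_sq_gaussianMeasure hα (differentiable_entireRep f)]

lemma exists_fockSpace {F : ℂ → ℂ} (hF : Differentiable ℂ F)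
    (h : ∫⁻ z, ‖F z‖ₑ ^ 2 ∂gaussianMeasure α < ⊤) :
    ∃ f : FockSpace α, (f : Lp ℂ 2 (gaussianMeasure α)) =ᵐ[gaussianMeasure α] F := by
  have hm : MemLp F 2 (gaussianMeasure α) := by
    refine ⟨hF.continuous.aestronglyMeasurable, ?_⟩
    rw [eLpNorm_lt_top_iff_lintegral_rpow_enorm_lt_top (by simp) (by simp)]
    simpa using h
  exact ⟨⟨hm.toLp F, F, hF, hm.coeFn_toLp⟩, hm.coeFn_toLp⟩

lemma taylorCoeff_add {F G : ℂ → ℂ} (hF : Differentiable ℂ F) (hG : Differentiable ℂ G) (n : ℕ) :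
    taylorCoeff (F + G) n = taylorCoeff F n + taylorCoeff G n := by
  rw [taylorCoeff, iteratedDeriv_add hF.contDiff.contDiffAt hG.contDiff.contDiffAt, mul_add]
  rfl

lemma taylorCoeff_smul {F : ℂ → ℂ} (hF : Differentiable ℂ F) (c : ℂ) (n : ℕ) :
    taylorCoeff (c • F) n = c * taylorCoeff F n := by
  rw [taylorCoeff, iteratedDeriv_const_smul hF.contDiff.contDiffAt c, smul_eq_mul, mul_left_comm]
  rfl

/-- An entire function with prescribed Taylor coefficients. -/
lemma exists_entire_of_taylorCoeff {c : ℕ → ℂ}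
    (hc : ∀ r : ℝ, 0 ≤ r → Summable fun n => ‖c n‖ * r ^ n) :
    ∃ F : ℂ → ℂ, Differentiable ℂ F ∧ ∀ n, taylorCoeff F n = c n := by
  set P := FormalMultilinearSeries.ofScalars ℂ c with hP
  have hr : P.radius = ⊤ := by
    refine P.radius_eq_top_of_summable_norm fun r => ?_
    simpa [hP, FormalMultilinearSeries.ofScalars_norm] using hc r r.2
  have hs := P.hasFPowerSeriesOnBall (by rw [hr]; simp)
  rw [hr] at hs
  refine ⟨P.sum, fun z => (hs.analyticAt_of_mem (by simp)).differentiableAt, fun n => ?_⟩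
  have h := hs.factorial_smul 1 n
  rw [← iteratedDeriv_eq_iteratedFDeriv] at h
  rw [taylorCoeff, ← h, hP, FormalMultilinearSeries.ofScalars_apply_eq]
  have : (n.factorial : ℂ) ≠ 0 := by exact_mod_cast n.factorial_ne_zero
  simp [this]

/-- The weights `(n! / αⁿ)^{1/2}` that turn Taylor coefficients into orthonormal coordinates. -/
def coordWeight (α : ℝ) (n : ℕ) : ℝ := Real.sqrt (n.factorial / α ^ n)

lemma coordWeight_pos (hα : 0 < α) (n : ℕ) : 0 < coordWeight α n :=
  Real.sqrt_pos.2 (by positivity)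

lemma coordWeight_sq (hα : 0 < α) (n : ℕ) : coordWeight α n ^ 2 = n.factorial / α ^ n :=
  Real.sq_sqrt (by positivity)

lemma hasSum_coord_sq (hα : 0 < α) (f : FockSpace α) :
    HasSum (fun n => ‖(coordWeight α n : ℂ) * taylorCoeff (entireRep f) n‖ ^ 2) (‖f‖ ^ 2) := by
  have h := enorm_sq_eq_tsum hα f
  have h1 (n : ℕ) : ‖taylorCoeff (entireRep f) n‖ₑ ^ 2 * ENNReal.ofReal (n.factorial / α ^ n) =
      ENNReal.ofReal (‖(coordWeight α n : ℂ) * taylorCoeff (entireRep f) n‖ ^ 2) := by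
    rw [norm_mul, mul_pow, Complex.norm_real, Real.norm_of_nonneg (coordWeight_pos hα n).le,
      coordWeight_sq hα, mul_comm, ENNReal.ofReal_mul (by positivity),
      ENNReal.ofReal_pow (norm_nonneg _), ofReal_norm]
  simp only [h1] at h
  have h2 : ‖f‖ₑ ^ 2 ≠ ⊤ := by simp
  have h3 : Summable fun n => ‖(coordWeight α n : ℂ) * taylorCoeff (entireRep f) n‖ ^ 2 := by
    have := ENNReal.summable_toReal (h ▸ h2)
    refine this.congr fun n => ?_
    rw [ENNReal.toReal_ofReal (by positivity)]
  rw [← ENNReal.ofReal_tsum_of_nonneg (fun n => by positivity) h3, ← ofReal_norm,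
    ← ENNReal.ofReal_pow (norm_nonneg _), ENNReal.ofReal_eq_ofReal_iff (by positivity)
      (tsum_nonneg fun n => by positivity)] at h
  rw [h]
  exact h3.hasSum

/-- Orthonormal coordinates on the Fock space, as a linear isometry into `ℓ²`. -/
def coordIsometry (hα : 0 < α) : FockSpace α →ₗᵢ[ℂ] lp (fun _ : ℕ => ℂ) 2 where
  toFun f := ⟨fun n => (coordWeight α n : ℂ) * taylorCoeff (entireRep f) n,
    memℓp_gen (by simpa using (hasSum_coord_sq hα f).summable)⟩
  map_add' f h := by
    ext n
    simp [entireRep_add hα, taylorCoeff_add (differentiable_entireRep f)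
      (differentiable_entireRep h), mul_add]
    rfl
  map_smul' c f := by
    ext n
    simp [entireRep_smul hα, taylorCoeff_smul (differentiable_entireRep f), mul_left_comm]
  norm_map' f := by
    have h1 := lp.norm_rpow_eq_tsum (p := 2) (by simp) (⟨fun n => (coordWeight α n : ℂ) *
      taylorCoeff (entireRep f) n, memℓp_gen (by simpa using (hasSum_coord_sq hα f).summable)⟩ :
        lp (fun _ : ℕ => ℂ) 2)
    simp only [ENNReal.toReal_ofNat, Real.rpow_two, (hasSum_coord_sq hα f).tsum_eq] at h1
    exact (sq_eq_sq₀ (norm_nonneg _) (norm_nonneg _)).1 h1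

lemma summable_pow_div_coordWeight (hα : 0 < α) (r : ℝ) :
    Summable fun n => (coordWeight α n)⁻¹ * r ^ n := by
  have h1 : Summable fun n : ℕ => (α * (2 * r) ^ 2) ^ n / n.factorial :=
    Real.summable_pow_div_factorial _
  have h2 : Summable fun n : ℕ => ((1 / 4 : ℝ)) ^ n :=
    summable_geometric_of_lt_one (by norm_num) (by norm_num)
  -- the terms are products of the square roots of terms of two convergent series
  refine Summable.of_norm_bounded (h1.add h2) fun n => ?_
  have h3 : ((coordWeight α n)⁻¹ * (2 * r) ^ n) ^ 2 = (α * (2 * r) ^ 2) ^ n / n.factorial := by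
    rw [mul_pow, inv_pow, coordWeight_sq hα, inv_div, mul_pow α, ← pow_mul, ← pow_mul,
      mul_comm n 2]
    ring
  have h4 : (((1 / 2 : ℝ)) ^ n) ^ 2 = (1 / 4) ^ n := by
    rw [← pow_mul, mul_comm, pow_mul]
    norm_num
  have h5 : (coordWeight α n)⁻¹ * r ^ n =
      (coordWeight α n)⁻¹ * (2 * r) ^ n * (1 / 2 : ℝ) ^ n := by
    rw [mul_assoc, ← mul_pow]
    congr 2
    ring
  rw [h5, ← h3, ← h4, Real.norm_eq_abs, abs_le]
  constructor <;> nlinarith [sq_nonneg ((coordWeight α n)⁻¹ * (2 * r) ^ n - (1 / 2 : ℝ) ^ n),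
    sq_nonneg ((coordWeight α n)⁻¹ * (2 * r) ^ n + (1 / 2 : ℝ) ^ n)]

lemma coordIsometry_surjective (hα : 0 < α) : Function.Surjective (coordIsometry hα) := by
  intro x
  have hw := coordWeight_pos hα
  obtain ⟨F, hF, hFc⟩ := exists_entire_of_taylorCoeff
    (c := fun n => ((coordWeight α n)⁻¹ : ℝ) * x n) fun r hr => by
      refine Summable.of_nonneg_of_le (fun n => by positivity) (fun n => ?_)
        ((summable_pow_div_coordWeight hα r).mul_left ‖x‖)
      have h0 : 0 < (coordWeight α n)⁻¹ := inv_pos.2 (hw n)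
      rw [norm_mul, Complex.norm_real, Real.norm_of_nonneg h0.le, mul_comm _ ‖x n‖, mul_assoc]
      gcongr
      exact lp.norm_apply_le_norm two_ne_zero x n
  have hcoord (n : ℕ) : (coordWeight α n : ℂ) * taylorCoeff F n = x n := by
    have : (coordWeight α n : ℂ) ≠ 0 := by exact_mod_cast (hw n).ne'
    rw [hFc, Complex.ofReal_inv, mul_inv_cancel_left₀ this]
  have hx : Summable fun n => ‖x n‖ ^ 2 := by
    simpa using (lp.memℓp x).summable (by simp)
  obtain ⟨f, hf⟩ := exists_fockSpace (α := α) hF (by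
    rw [lintegral_enorm_sq_gaussianMeasure hα hF]
    have h1 (n : ℕ) : ‖taylorCoeff F n‖ₑ ^ 2 * ENNReal.ofReal (n.factorial / α ^ n) =
        ENNReal.ofReal (‖x n‖ ^ 2) := by
      rw [← hcoord, norm_mul, mul_pow, Complex.norm_real, Real.norm_of_nonneg (hw n).le,
        coordWeight_sq hα, mul_comm, ENNReal.ofReal_mul (by positivity),
        ENNReal.ofReal_pow (norm_nonneg _), ofReal_norm]
    simp only [h1]
    rw [← ENNReal.ofReal_tsum_of_nonneg (fun n => by positivity) hx]
    exact ENNReal.ofReal_lt_top)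
  refine ⟨f, ?_⟩
  ext n
  simp only [coordIsometry, LinearIsometry.coe_mk, LinearMap.coe_mk, AddHom.coe_mk]
  rw [entireRep_eq hα hF hf]
  exact hcoord n

/-- Orthonormal coordinates identify the Fock space with `ℓ²`. -/
def coordEquiv (hα : 0 < α) : FockSpace α ≃ₗᵢ[ℂ] lp (fun _ : ℕ => ℂ) 2 :=
  LinearIsometryEquiv.ofSurjective (coordIsometry hα) (coordIsometry_surjective hα)

lemma coordEquiv_apply (hα : 0 < α) (f : FockSpace α) (n : ℕ) :
    coordEquiv hα f n = (coordWeight α n : ℂ) * taylorCoeff (entireRep f) n := rfl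

lemma completeSpace_fockSpace (hα : 0 < α) : CompleteSpace (FockSpace α) :=
  (coordEquiv hα).isometry.isUniformInducing.completeSpace_congr (coordEquiv hα).surjective |>.2
    inferInstance

instance : TopologicalSpace.SeparableSpace (FockSpace α) := by
  have : SigmaFinite (gaussianMeasure α) := by unfold gaussianMeasure; infer_instance
  have : Fact ((2 : ℝ≥0∞) ≠ ⊤) := ⟨by simp⟩
  infer_instance

/-- The constant function `1`, as a vector of the Fock space. -/
def oneVec (hα : 0 < α) : FockSpace α := (coordEquiv hα).symm (lp.single 2 0 1)

lemma norm_oneVec (hα : 0 < α) : ‖oneVec hα‖ = 1 := by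
  rw [oneVec, LinearIsometryEquiv.norm_map, lp.norm_single (by simp), norm_one]

lemma inner_oneVec (hα : 0 < α) (f : FockSpace α) :
    inner ℂ (oneVec hα) f = entireRep f 0 := by
  rw [oneVec, ← (coordEquiv hα).inner_map_map, LinearIsometryEquiv.apply_symm_apply,
    lp.inner_single_left, coordEquiv_apply, taylorCoeff_zero]
  simp [coordWeight]

lemma hasSum_derivNormSq (hα : 0 < α) (r : ℝ) :
    HasSum (fun n : ℕ => (((n : ℝ) + 1) * r ^ n * (coordWeight α (n + 1))⁻¹) ^ 2)
      (derivNormSq α r) := by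
  have h1 : HasSum (fun n : ℕ => (α * r ^ 2) ^ n / n.factorial) (Real.exp (α * r ^ 2)) := by
    rw [Real.exp_eq_exp_ℝ]
    exact NormedSpace.expSeries_div_hasSum_exp _
  have h2 : HasSum (fun n : ℕ => (n : ℝ) * ((α * r ^ 2) ^ n / n.factorial))
      (α * r ^ 2 * Real.exp (α * r ^ 2)) := by
    rw [← hasSum_nat_add_iff' 1]
    convert! h1.mul_left (α * r ^ 2) using 1
    · ext n
      rw [Nat.factorial_succ]
      push_cast
      field_simp
      ring
    · simp
  convert! (h1.add h2).mul_left α using 1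
  · ext n
    rw [mul_pow, inv_pow, coordWeight_sq hα, Nat.factorial_succ]
    push_cast
    field_simp
    ring
  · rw [derivNormSq]
    ring

/-- The vector of the Fock space that represents the functional `f ↦ f'(w)`. -/
lemma exists_derivVec (hα : 0 < α) (w : ℂ) : ∃ v : FockSpace α,
    ‖v‖ ^ 2 = derivNormSq α ‖w‖ ∧ ∀ f, inner ℂ v f = deriv (entireRep f) w := by
  let x : ℕ → ℂ := fun n => (n : ℂ) * (starRingEnd ℂ) w ^ (n - 1) * ((coordWeight α n)⁻¹ : ℝ)
  have hx : HasSum (fun n => ‖x n‖ ^ 2) (derivNormSq α ‖w‖) := by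
    rw [← hasSum_nat_add_iff' 1]
    convert! hasSum_derivNormSq hα ‖w‖ using 1
    · ext n
      have h0 : 0 < (coordWeight α (n + 1))⁻¹ := inv_pos.2 (coordWeight_pos hα _)
      simp only [x, norm_mul, norm_pow, RCLike.norm_conj, Complex.norm_real,
        Real.norm_of_nonneg h0.le, Complex.norm_natCast, Nat.add_sub_cancel]
      push_cast
      rfl
    · simp [x]
  let X : lp (fun _ : ℕ => ℂ) 2 := ⟨x, memℓp_gen (by simpa using hx.summable)⟩
  refine ⟨(coordEquiv hα).symm X, ?_, fun f => ?_⟩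
  · rw [LinearIsometryEquiv.norm_map]
    have h1 := lp.norm_rpow_eq_tsum (p := 2) (by simp) X
    simp only [ENNReal.toReal_ofNat, Real.rpow_two] at h1
    rw [h1]
    exact hx.tsum_eq
  · rw [← (coordEquiv hα).inner_map_map, LinearIsometryEquiv.apply_symm_apply]
    have h1 := lp.hasSum_inner (𝕜 := ℂ) X (coordEquiv hα f)
    refine h1.unique ?_
    rw [← hasSum_nat_add_iff' 1]
    convert! hasSum_taylorCoeff (differentiable_entireRep f).deriv w using 1
    · ext n
      have h0 : (coordWeight α (n + 1) : ℂ) ≠ 0 := by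
        exact_mod_cast (coordWeight_pos hα (n + 1)).ne'
      rw [coordEquiv_apply, taylorCoeff_deriv, RCLike.inner_apply']
      simp only [X, x, map_mul, map_pow, Complex.conj_conj, Complex.conj_ofReal, map_natCast,
        Nat.add_sub_cancel]
      push_cast
      field_simp
    · simp [X, x]

end Fock

/-! ### Consequences of Jensen's formula -/

section JensenFormula

open Real (circleAverage)
open Filter

lemma circleIntegrable_log_norm {F : ℂ → ℂ} (hF : Differentiable ℂ F) (r : ℝ) :
    CircleIntegrable (fun z => Real.log ‖F z‖) 0 r :=
  MeromorphicOn.circleIntegrable_log_norm fun z _ => (hF.analyticAt z).meromorphicAt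

lemma circleIntegrable_of_continuous {f : ℂ → ℝ} (hf : Continuous f) (r : ℝ) :
    CircleIntegrable f 0 r :=
  (hf.comp (continuous_circleMap 0 r)).intervalIntegrable _ _

/-- The mean value over a circle is monotone for functions compared off the zeros of a nonzero
entire function. -/
lemma circleAverage_mono_of_ne_zero {F : ℂ → ℂ} (hF : Differentiable ℂ F) {w : ℂ} (hw : F w ≠ 0)
    {u v : ℂ → ℝ} {r : ℝ} (hr : 0 < r) (hu : CircleIntegrable u 0 r) (hv : CircleIntegrable v 0 r)
    (huv : ∀ z, F z ≠ 0 → ‖z‖ = r → u z ≤ v z) : circleAverage u 0 r ≤ circleAverage v 0 r := by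
  rw [Real.circleAverage_def, Real.circleAverage_def, smul_eq_mul, smul_eq_mul]
  refine mul_le_mul_of_nonneg_left ?_ (by positivity)
  refine intervalIntegral.integral_mono_ae_restrict (by positivity) hu hv ?_
  have h1 : F ⁻¹' {0}ᶜ ∈ codiscreteWithin (Metric.sphere (0 : ℂ) |r|) :=
    codiscreteWithin_mono (by tauto)
      (AnalyticOnNhd.preimage_zero_mem_codiscrete (fun z _ => hF.analyticAt z) hw)
  refine ae_restrict_le_codiscreteWithin measurableSet_Icc ?_
  refine codiscreteWithin_mono (Set.subset_univ _) ?_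
  refine mem_of_superset (circleMap_preimage_codiscrete hr.ne' h1) fun θ hθ => ?_
  exact huv _ hθ (by rw [norm_circleMap_zero, abs_of_pos hr])

/-- The lower bound for the means of `log |F|` in Jensen's formula. The terms of the formula that
come from zeros off the origin are nonnegative; the one from a zero at the origin is so for
`1 ≤ r`. -/
lemma log_norm_le_circleAverage {F : ℂ → ℂ} (hF : Differentiable ℂ F) {r : ℝ} (hr : 0 < r)
    (h : 1 ≤ r ∨ F 0 ≠ 0) :
    Real.log ‖meromorphicTrailingCoeffAt F 0‖ ≤ circleAverage (fun z => Real.log ‖F z‖) 0 r := by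
  have han : AnalyticOnNhd ℂ F (Metric.closedBall 0 |r|) := fun z _ => hF.analyticAt z
  have hdiv : ∀ u, 0 ≤ MeromorphicOn.divisor F (Metric.closedBall 0 |r|) u :=
    fun u => MeromorphicOn.AnalyticOnNhd.divisor_nonneg han u
  rw [han.meromorphicOn.circleAverage_log_norm hr.ne']
  refine le_add_of_nonneg_left (add_nonneg (finsum_nonneg fun u => ?_) ?_)
  · by_cases hu : u ∈ Metric.closedBall (0 : ℂ) |r|
    · refine mul_nonneg (by exact_mod_cast hdiv u) ?_
      rcases eq_or_ne u 0 with rfl | hu0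
      · simp
      · rw [mem_closedBall_zero_iff, abs_of_pos hr] at hu
        refine Real.log_nonneg ?_
        rw [zero_sub, norm_neg, ← div_eq_mul_inv]
        exact (one_le_div (norm_pos_iff.2 hu0)).2 hu
    · rw [Function.locallyFinsuppWithin.apply_eq_zero_of_notMem _ hu]
      simp
  · rcases h with h | h
    · exact mul_nonneg (by exact_mod_cast hdiv 0) (Real.log_nonneg h)
    · rw [MeromorphicOn.AnalyticOnNhd.divisor_apply han (by simp),
        (hF.analyticAt 0).analyticOrderAt_eq_zero.mpr h]
      simp

/-- Powers of the modulus of an entire function are subharmonic: the mean value inequality at the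
origin. -/
lemma norm_rpow_le_circleAverage {F : ℂ → ℂ} (hF : Differentiable ℂ F) {p : ℝ} (hp : 0 < p)
    {r : ℝ} (hr : 0 < r) : ‖F 0‖ ^ p ≤ circleAverage (fun z => ‖F z‖ ^ p) 0 r := by
  have hc : Continuous fun z => ‖F z‖ ^ p :=
    hF.continuous.norm.rpow_const fun _ => Or.inr hp.le
  by_cases h0 : F 0 = 0
  · rw [h0, norm_zero, Real.zero_rpow hp.ne']
    exact Real.circleAverage_nonneg_of_nonneg fun z _ => by positivity
  set m := Real.log ‖F 0‖ with hm
  -- `x ^ p` lies above the tangent line of `exp` in the variable `p log x` at `p log |F 0|`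
  have h1 : circleAverage (fun z => Real.exp (p * m) * (p * (Real.log ‖F z‖ - m) + 1)) 0 r ≤
      circleAverage (fun z => ‖F z‖ ^ p) 0 r := by
    refine circleAverage_mono_of_ne_zero hF h0 hr ?_ (circleIntegrable_of_continuous hc r) ?_
    · exact ((((circleIntegrable_log_norm hF r).sub (circleIntegrable_const m 0 r)).const_mul
        p).add (circleIntegrable_const 1 0 r)).const_mul _
    · intro z hz _
      rw [Real.rpow_def_of_pos (norm_pos_iff.2 hz), show Real.log ‖F z‖ * p =
        p * m + p * (Real.log ‖F z‖ - m) by ring, Real.exp_add]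
      gcongr
      exact Real.add_one_le_exp _
  have h2 := log_norm_le_circleAverage hF hr (Or.inr h0)
  rw [(hF.analyticAt 0).meromorphicTrailingCoeffAt_of_ne_zero h0] at h2
  refine le_trans ?_ h1
  have h3 : circleAverage (fun z => Real.exp (p * m) * (p * (Real.log ‖F z‖ - m) + 1)) 0 r =
      Real.exp (p * m) * (p * (circleAverage (fun z => Real.log ‖F z‖) 0 r - m) + 1) := by
    have hi := circleIntegrable_log_norm hF r
    simp only [Real.circleAverage_def, smul_eq_mul, intervalIntegral.integral_const_mul]
    have hi' : IntervalIntegrable (fun θ => p * (Real.log ‖F (circleMap 0 r θ)‖ - m)) volume 0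
        (2 * Real.pi) := (hi.sub (circleIntegrable_const m 0 r)).const_mul p
    rw [intervalIntegral.integral_add hi' intervalIntegrable_const,
      intervalIntegral.integral_const_mul,
      intervalIntegral.integral_sub hi intervalIntegrable_const]
    simp only [intervalIntegral.integral_const, sub_zero, smul_eq_mul]
    field_simp [Real.pi_ne_zero]
  rw [h3, Real.rpow_def_of_pos (norm_pos_iff.2 h0), mul_comm _ p]
  refine le_mul_of_one_le_right (Real.exp_pos _).le ?_
  have := mul_nonneg hp.le (sub_nonneg.2 h2)
  linarith

lemma norm_rpow_mul_lintegral_le {F : ℂ → ℂ} (hF : Differentiable ℂ F) {p : ℝ} (hp : 0 < p)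
    {ω : ℝ → ℝ≥0∞} (hω : Measurable ω) :
    ENNReal.ofReal (‖F 0‖ ^ p) * ∫⁻ z : ℂ, ω ‖z‖ ≤ ∫⁻ z, ENNReal.ofReal (‖F z‖ ^ p) * ω ‖z‖ := by
  rw [← lintegral_const_mul' _ _ ENNReal.ofReal_ne_top,
    lintegral_mul_radial (f := fun _ => ‖F 0‖ ^ p) continuous_const (fun _ => by positivity) hω,
    lintegral_mul_radial (f := fun z => ‖F z‖ ^ p)
      (hF.continuous.norm.rpow_const fun _ => Or.inr hp.le) (fun _ => by positivity) hω]
  refine setLIntegral_mono' measurableSet_Ioi fun r hr => ?_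
  have h := norm_rpow_le_circleAverage hF hp hr
  rw [Real.circleAverage_const]
  gcongr

/-! ### The weight that governs boundedness -/

/-- The weight `|G(z)|^p e^{(pα/2)(|ψ(z)|² - |z|²)}`. -/
def weight (α p : ℝ) (G ψ : ℂ → ℂ) (z : ℂ) : ℝ :=
  ‖G z‖ ^ p * Real.exp (p * α / 2 * (‖ψ z‖ ^ 2 - ‖z‖ ^ 2))

lemma weight_nonneg (α p : ℝ) (G ψ : ℂ → ℂ) (z : ℂ) : 0 ≤ weight α p G ψ z := by
  unfold weight
  positivity

lemma continuous_weight {α p : ℝ} (hp : 0 < p) {G ψ : ℂ → ℂ} (hG : Continuous G)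
    (hψ : Continuous ψ) : Continuous (weight α p G ψ) := by
  unfold weight
  exact (hG.norm.rpow_const fun _ => Or.inr hp.le).mul (by fun_prop)

/-- For affine `ψ` an integrable weight is bounded. -/
lemma exists_weight_le {α p : ℝ} (hp : 0 < p) {G : ℂ → ℂ} (hG : Differentiable ℂ G) (a b : ℂ)
    (h : ∫⁻ z, ENNReal.ofReal (weight α p G (fun z => a * z + b) z) < ⊤) :
    ∃ K : ℝ, ∀ z, weight α p G (fun z => a * z + b) z ≤ K := by
  set ω : ℝ → ℝ := fun r => Real.exp (p * α / 2 * ((‖a‖ ^ 2 - 1) * r ^ 2)) with hω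
  have hωm : Measurable fun r => ENNReal.ofReal (ω r) := by fun_prop
  have hpos : (∫⁻ z : ℂ, ENNReal.ofReal (ω ‖z‖)) ≠ 0 := by
    rw [Ne, lintegral_eq_zero_iff (by fun_prop)]
    intro h0
    have h1 : ∀ᵐ _ : ℂ, False := h0.mono fun z hz =>
      (ENNReal.ofReal_pos.2 (Real.exp_pos _)).ne' hz
    exact h1.exists.elim fun _ => id
  set I := ∫⁻ z, ENNReal.ofReal (weight α p G (fun z => a * z + b) z)
  have key (z : ℂ) : ENNReal.ofReal (weight α p G (fun z => a * z + b) z) *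
      ∫⁻ z : ℂ, ENNReal.ofReal (ω ‖z‖) ≤ I := by
    -- up to a radial factor, the translate of the weight is the modulus of an entire function
    let F : ℂ → ℂ := fun ζ => G (z + ζ) *
      Complex.exp (α * ζ * (a * (starRingEnd ℂ) (a * z + b) - (starRingEnd ℂ) z))
    have hF : Differentiable ℂ F := by fun_prop
    have hFz (ζ : ℂ) : weight α p G (fun z => a * z + b) (z + ζ) =
        Real.exp (p * α / 2 * (‖a * z + b‖ ^ 2 - ‖z‖ ^ 2)) * (‖F ζ‖ ^ p * ω ‖ζ‖) := by
      have h1 : ‖a * (z + ζ) + b‖ ^ 2 - ‖z + ζ‖ ^ 2 = (‖a * z + b‖ ^ 2 - ‖z‖ ^ 2) +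
          2 * (ζ * (a * (starRingEnd ℂ) (a * z + b) - (starRingEnd ℂ) z)).re +
          (‖a‖ ^ 2 - 1) * ‖ζ‖ ^ 2 := by
        simp only [Complex.sq_norm, Complex.normSq_apply, Complex.add_re, Complex.add_im,
          Complex.mul_re, Complex.mul_im, Complex.sub_re, Complex.sub_im, Complex.conj_re,
          Complex.conj_im]
        ring
      have h2 : ‖F ζ‖ ^ p = ‖G (z + ζ)‖ ^ p * Real.exp (p * α *
          (ζ * (a * (starRingEnd ℂ) (a * z + b) - (starRingEnd ℂ) z)).re) := by
        simp only [F, norm_mul, Complex.norm_exp]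
        rw [Real.mul_rpow (norm_nonneg _) (Real.exp_pos _).le, ← Real.exp_mul, mul_assoc (α : ℂ),
          Complex.re_ofReal_mul]
        congr 2
        ring
      rw [h2, weight]
      simp only [ω]
      rw [h1, mul_left_comm, mul_assoc, ← Real.exp_add, ← Real.exp_add]
      congr 2
      ring
    have h1 := norm_rpow_mul_lintegral_le hF hp hωm
    have h2 : I = ∫⁻ ζ, ENNReal.ofReal (weight α p G (fun z => a * z + b) (z + ζ)) :=
      (lintegral_add_left_eq_self _ z).symm
    have h3 : weight α p G (fun z => a * z + b) z =
        Real.exp (p * α / 2 * (‖a * z + b‖ ^ 2 - ‖z‖ ^ 2)) * ‖F 0‖ ^ p := by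
      have := hFz 0
      rw [add_zero] at this
      rw [this]
      simp [ω]
    rw [h2, h3]
    simp only [hFz]
    rw [ENNReal.ofReal_mul (Real.exp_pos _).le, mul_assoc]
    simp only [ENNReal.ofReal_mul (Real.exp_pos (p * α / 2 * (‖a * z + b‖ ^ 2 - ‖z‖ ^ 2))).le]
    rw [lintegral_const_mul' _ _ ENNReal.ofReal_ne_top]
    gcongr
    refine h1.trans (le_of_eq ?_)
    refine lintegral_congr fun ζ => ?_
    rw [ENNReal.ofReal_mul (by positivity)]
  refine ⟨(I / ∫⁻ z : ℂ, ENNReal.ofReal (ω ‖z‖)).toReal, fun z => ?_⟩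
  have h1 := ENNReal.le_div_iff_mul_le (Or.inl hpos) (Or.inr h.ne) |>.2 (key z)
  rw [← ENNReal.ofReal_le_iff_le_toReal (ENNReal.div_lt_top h.ne hpos).ne]
  exact h1

/-- An entire function whose Taylor coefficients vanish from order two on is affine. -/
lemma exists_affine_of_taylorCoeff {ψ : ℂ → ℂ} (hψ : Differentiable ℂ ψ)
    (h : ∀ m, 2 ≤ m → taylorCoeff ψ m = 0) : ∃ a b : ℂ, ∀ z, ψ z = a * z + b := by
  refine ⟨taylorCoeff ψ 1, taylorCoeff ψ 0, fun z => ?_⟩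
  refine (hasSum_taylorCoeff hψ z).unique ?_
  have : HasSum (fun n => taylorCoeff ψ n * z ^ n) _ :=
    hasSum_sum_of_ne_finset_zero (f := fun n => taylorCoeff ψ n * z ^ n)
    (s := Finset.range 2) fun n hn => by
      rw [h n (by simp at hn; omega), zero_mul]
  simpa [Finset.sum_range_succ, add_comm] using this

/-- If the weight has at most quadratic growth in the mean over arbitrarily large circles, then
`ψ` is affine: by Jensen's formula the means of `|ψ|²` then grow at most quadratically. -/
lemma exists_affine_of_frequently {α p : ℝ} (hα : 0 < α) (hp : 0 < p) {G ψ : ℂ → ℂ}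
    (hG : Differentiable ℂ G) (hψ : Differentiable ℂ ψ) {w : ℂ} (hw : G w ≠ 0) {K : ℝ}
    (h : ∃ᶠ r in atTop, circleAverage (weight α p G ψ) 0 r ≤ K * r ^ 2) :
    ∃ a b : ℂ, ∀ z, ψ z = a * z + b := by
  refine exists_affine_of_taylorCoeff hψ fun m hm => ?_
  by_contra hm0
  set L := Real.log ‖meromorphicTrailingCoeffAt G 0‖ with hL
  have hbound (r : ℝ) (hr : 1 ≤ r) (hK : circleAverage (weight α p G ψ) 0 r ≤ K * r ^ 2) :
      p * (L + α / 2 * (‖taylorCoeff ψ m‖ ^ 2 * r ^ (2 * m) - r ^ 2)) ≤ K * r ^ 2 := by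
    have hr0 : 0 < r := by linarith
    have hi := circleIntegrable_log_norm hG r
    have hc : Continuous fun z => ‖ψ z‖ ^ 2 := hψ.continuous.norm.pow 2
    have hi2 := circleIntegrable_of_continuous hc r
    have h1 : circleAverage (fun z => p * (Real.log ‖G z‖ + α / 2 * (‖ψ z‖ ^ 2 - r ^ 2))) 0 r ≤
        circleAverage (weight α p G ψ) 0 r := by
      refine circleAverage_mono_of_ne_zero hG hw hr0 ?_
        (circleIntegrable_of_continuous (continuous_weight hp hG.continuous hψ.continuous) r) ?_
      · exact (hi.add (circleIntegrable_of_continuous (f := fun z => α / 2 * (‖ψ z‖ ^ 2 - r ^ 2))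
          (by fun_prop) r)).const_mul p
      · intro z hz hzr
        rw [weight, Real.rpow_def_of_pos (norm_pos_iff.2 hz), ← Real.exp_add, hzr]
        refine le_trans (le_of_eq ?_) ((le_add_of_nonneg_right zero_le_one).trans
          (Real.add_one_le_exp _))
        ring
    have h2 : circleAverage (fun z => p * (Real.log ‖G z‖ + α / 2 * (‖ψ z‖ ^ 2 - r ^ 2))) 0 r =
        p * (circleAverage (fun z => Real.log ‖G z‖) 0 r +
          α / 2 * (circleAverage (fun z => ‖ψ z‖ ^ 2) 0 r - r ^ 2)) := by
      simp only [Real.circleAverage_def, smul_eq_mul, intervalIntegral.integral_const_mul]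
      have hi3 : IntervalIntegrable (fun θ => α / 2 * (‖ψ (circleMap 0 r θ)‖ ^ 2 - r ^ 2)) volume 0
          (2 * Real.pi) := (hi2.sub (circleIntegrable_const _ 0 r)).const_mul _
      rw [intervalIntegral.integral_add hi hi3,
        intervalIntegral.integral_const_mul,
        intervalIntegral.integral_sub hi2 intervalIntegrable_const]
      simp only [intervalIntegral.integral_const, sub_zero, smul_eq_mul]
      field_simp [Real.pi_ne_zero]
    rw [h2] at h1
    refine le_trans ?_ (h1.trans hK)
    have h3 := log_norm_le_circleAverage hG hr0 (Or.inl hr)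
    have h4 := le_hasSum (hasSum_circleAverage_norm_sq hψ r) m fun j _ => by positivity
    gcongr
  -- compare growth: the left side is of order `r ^ (2 * m)` with `m ≥ 2`
  have hd : 0 < ‖taylorCoeff ψ m‖ ^ 2 := by positivity
  set d := ‖taylorCoeff ψ m‖ ^ 2
  have hlim : Tendsto (fun r : ℝ => p * α / 2 * d * r ^ 2) atTop atTop :=
    (tendsto_pow_atTop two_ne_zero).const_mul_atTop (by positivity)
  obtain ⟨r, ⟨hr1, hr2⟩, hr3⟩ := (((eventually_ge_atTop (1 : ℝ)).and
    (hlim.eventually_gt_atTop (K + p * |L| + p * α / 2))).and_frequently h).exists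
  have h1 := hbound r hr1 hr3
  have h2 : r ^ 4 ≤ r ^ (2 * m) := pow_le_pow_right₀ hr1 (by omega)
  have h3 : p * (L + α / 2 * (d * r ^ 4 - r ^ 2)) ≤ K * r ^ 2 := by
    refine le_trans ?_ h1
    gcongr
  have h4 : 1 ≤ r ^ 2 := one_le_pow₀ hr1
  have h5 : -(p * |L|) * r ^ 2 ≤ p * L := by
    have : -|L| ≤ L := neg_abs_le L
    have h6 : 0 ≤ p * |L| := by positivity
    nlinarith
  nlinarith

lemma exists_affine_of_lintegral {α p : ℝ} (hα : 0 < α) (hp : 0 < p) {G ψ : ℂ → ℂ}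
    (hG : Differentiable ℂ G) (hψ : Differentiable ℂ ψ) {w : ℂ} (hw : G w ≠ 0)
    (h : ∫⁻ z, ENNReal.ofReal (weight α p G ψ z) < ⊤) : ∃ a b : ℂ, ∀ z, ψ z = a * z + b := by
  refine exists_affine_of_frequently hα hp hG hψ hw (K := 1) ?_
  by_contra hcon
  rw [not_frequently] at hcon
  obtain ⟨R, hR⟩ := eventually_atTop.1 hcon
  have h1 := lintegral_mul_radial (continuous_weight hp hG.continuous hψ.continuous)
    (weight_nonneg α p G ψ) (ω := fun _ => 1) measurable_const
  simp only [mul_one] at h1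
  rw [h1] at h
  refine h.ne (top_le_iff.1 ?_)
  set M := max R 1
  calc (⊤ : ℝ≥0∞) = ∫⁻ r in Set.Ioi M, 1 := by simp
    _ ≤ ∫⁻ r in Set.Ioi M, ENNReal.ofReal (2 * Real.pi * circleAverage (weight α p G ψ) 0 r) *
          ENNReal.ofReal r := by
        refine setLIntegral_mono' measurableSet_Ioi fun r hr => ?_
        have hr : M < r := hr
        have hr1 : 1 ≤ r := (le_max_right R 1).trans hr.le
        have h2 := hR r ((le_max_left R 1).trans hr.le)
        rw [← ENNReal.ofReal_one]
        refine le_trans ?_ (mul_le_mul' (ENNReal.ofReal_le_ofReal (p := 1) ?_)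
          (ENNReal.ofReal_le_ofReal hr1))
        · simp
        · have h3 : 1 ≤ r ^ 2 := one_le_pow₀ hr1
          have h4 := Real.pi_gt_three
          nlinarith
    _ ≤ _ := lintegral_mono_set (Set.Ioi_subset_Ioi (zero_le_one.trans (le_max_right R 1)))

lemma exists_affine_of_le {α : ℝ} (hα : 0 < α) {G ψ : ℂ → ℂ}
    (hG : Differentiable ℂ G) (hψ : Differentiable ℂ ψ) {w : ℂ} (hw : G w ≠ 0) {K : ℝ}
    (h : ∀ z, weight α 2 G ψ z ≤ K * (1 + α * ‖z‖ ^ 2)) : ∃ a b : ℂ, ∀ z, ψ z = a * z + b := by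
  refine exists_affine_of_frequently hα two_pos hG hψ hw (K := K * (1 + α)) ?_
  refine ((eventually_ge_atTop 1).mono fun r hr => ?_).frequently
  refine Real.circleAverage_mono_on_of_le_circle (circleIntegrable_of_continuous
    (continuous_weight two_pos hG.continuous hψ.continuous) r) fun z hz => ?_
  rw [mem_sphere_zero_iff_norm, abs_of_pos (by linarith)] at hz
  refine (h z).trans ?_
  rw [hz]
  have hK : 0 ≤ K := by
    have := (weight_nonneg α 2 G ψ 0).trans (h 0)
    simpa using this
  have : 1 ≤ r ^ 2 := one_le_pow₀ hr
  rw [mul_assoc]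
  gcongr
  nlinarith

end JensenFormula

/-! ### Complex line integrals of entire functions -/

lemma lineIntegral_zero (h : ℂ → ℂ) : lineIntegral h 0 = 0 := by
  simp [lineIntegral]

lemma lineIntegral_eq_sub {h P : ℂ → ℂ} (hh : Continuous h) {z : ℂ}
    (hP : ∀ t ∈ Set.uIcc (0 : ℝ) 1, HasDerivAt P (h (t * z)) (t * z)) :
    lineIntegral h z = P z - P 0 := by
  have h1 (t : ℝ) (ht : t ∈ Set.uIcc (0 : ℝ) 1) :
      HasDerivAt (fun t : ℝ => P (t * z)) (h (t * z) * z) t := by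
    have h2 : HasDerivAt (fun s : ℂ => s * z) z (t : ℂ) := by
      simpa using (hasDerivAt_id (t : ℂ)).mul_const z
    exact ((hP t ht).comp (t : ℂ) h2).comp_ofReal
  have h3 := intervalIntegral.integral_eq_sub_of_hasDerivAt h1
    (Continuous.intervalIntegrable (by fun_prop) _ _)
  rw [intervalIntegral.integral_mul_const] at h3
  simpa [lineIntegral, mul_comm] using h3

/-- The line integral from the origin is a primitive of an entire function. -/
lemma hasDerivAt_lineIntegral {h : ℂ → ℂ} (hh : Differentiable ℂ h) (z : ℂ) :
    HasDerivAt (lineIntegral h) (h z) z := by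
  obtain ⟨P, hP⟩ := (hh.differentiableOn (s := Metric.ball 0 (‖z‖ + 1))).isExactOn_ball
  have hz : z ∈ Metric.ball (0 : ℂ) (‖z‖ + 1) := by simp
  have h1 : Set.EqOn (lineIntegral h) (fun w => P w - P 0) (Metric.ball 0 (‖z‖ + 1)) := by
    intro w hw
    refine lineIntegral_eq_sub hh.continuous fun t ht => hP _ ?_
    rw [Set.uIcc_of_le zero_le_one] at ht
    rw [mem_ball_zero_iff] at hw ⊢
    rw [norm_mul, Complex.norm_real, Real.norm_of_nonneg ht.1]
    exact (mul_le_of_le_one_left (norm_nonneg w) ht.2).trans_lt hw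
  exact ((hP z hz).sub_const (P 0)).congr_of_eventuallyEq
    (h1.eventuallyEq_of_mem (Metric.isOpen_ball.mem_nhds hz))

lemma lineIntegral_add {h k : ℂ → ℂ} (hh : Continuous h) (hk : Continuous k)
    (z : ℂ) : lineIntegral (fun w => h w + k w) z = lineIntegral h z + lineIntegral k z := by
  unfold lineIntegral
  rw [intervalIntegral.integral_add (Continuous.intervalIntegrable (by fun_prop) _ _)
    (Continuous.intervalIntegrable (by fun_prop) _ _), mul_add]

lemma lineIntegral_const_mul (c : ℂ) (h : ℂ → ℂ) (z : ℂ) :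
    lineIntegral (fun w => c * h w) z = c * lineIntegral h z := by
  unfold lineIntegral
  rw [intervalIntegral.integral_const_mul, mul_left_comm]

variable {α : ℝ}

/-! ### The derivative frame of the Fock space -/

/-- The normalized vector of the Fock space that represents, up to a positive factor, the
functional `f ↦ f' w`. -/
def derivUnitVec (hα : 0 < α) (w : ℂ) : FockSpace α :=
  (((Real.sqrt (derivNormSq α ‖w‖))⁻¹ : ℝ) : ℂ) • (exists_derivVec hα w).choose

lemma norm_derivUnitVec (hα : 0 < α) (w : ℂ) : ‖derivUnitVec hα w‖ = 1 := by
  have h := (exists_derivVec hα w).choose_spec.1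
  have h0 := derivNormSq_pos hα ‖w‖
  rw [derivUnitVec, norm_smul, Complex.norm_real, Real.norm_of_nonneg (by positivity),
    ← Real.sqrt_sq (norm_nonneg (exists_derivVec hα w).choose), h,
    inv_mul_cancel₀ (Real.sqrt_pos.2 h0).ne']

lemma inner_derivUnitVec (hα : 0 < α) (w : ℂ) (f : FockSpace α) :
    inner ℂ (derivUnitVec hα w) f =
      (((Real.sqrt (derivNormSq α ‖w‖))⁻¹ : ℝ) : ℂ) * deriv (entireRep f) w := by
  refine (inner_smul_left (𝕜 := ℂ) (E := FockSpace α) _ _ _).trans ?_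
  rw [(exists_derivVec hα w).choose_spec.2, Complex.conj_ofReal]

lemma continuous_deriv_entireRep (f : FockSpace α) : Continuous (deriv (entireRep f)) :=
  ((differentiable_entireRep f).contDiff (n := 1)).continuous_deriv le_rfl

lemma continuous_inner_derivUnitVec (hα : 0 < α) (f : FockSpace α) :
    Continuous fun w => inner ℂ (derivUnitVec hα w) f := by
  simp only [inner_derivUnitVec]
  have := continuous_deriv_entireRep f
  have h : Continuous fun w : ℂ => (Real.sqrt (derivNormSq α ‖w‖))⁻¹ :=
    Continuous.inv₀ (by fun_prop) fun w => (Real.sqrt_pos.2 (derivNormSq_pos hα _)).ne'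
  fun_prop

lemma enorm_inner_derivUnitVec_sq (hα : 0 < α) (w : ℂ) (f : FockSpace α) :
    ‖inner ℂ (derivUnitVec hα w) f‖ₑ ^ 2 =
      ‖deriv (entireRep f) w‖ₑ ^ 2 * ENNReal.ofReal ((derivNormSq α ‖w‖)⁻¹) := by
  have h0 := derivNormSq_pos hα ‖w‖
  rw [inner_derivUnitVec, enorm_mul, mul_pow, mul_comm]
  congr 1
  rw [← ofReal_norm, Complex.norm_real, Real.norm_of_nonneg (by positivity),
    ← ENNReal.ofReal_pow (by positivity), inv_pow, Real.sq_sqrt h0.le]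

lemma enorm_sq_eq_add_tsum (hα : 0 < α) (f : FockSpace α) :
    ‖f‖ₑ ^ 2 = ‖entireRep f 0‖ₑ ^ 2 + ∑' n, ‖taylorCoeff (entireRep f) (n + 1)‖ₑ ^ 2 *
      ENNReal.ofReal ((n + 1).factorial / α ^ (n + 1)) := by
  rw [enorm_sq_eq_tsum hα, tsum_eq_zero_add' ENNReal.summable, taylorCoeff_zero]
  simp

lemma lintegral_inner_derivUnitVec_le (hα : 0 < α) (f : FockSpace α) :
    ∫⁻ w, ‖inner ℂ (derivUnitVec hα w) f‖ₑ ^ 2 ≤ ENNReal.ofReal (2 * Real.pi / α) * ‖f‖ₑ ^ 2 := by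
  simp only [enorm_inner_derivUnitVec_sq, enorm_sq_eq_add_tsum hα f]
  refine (lintegral_deriv_sq_le hα (differentiable_entireRep f)).trans ?_
  gcongr
  exact le_add_self

/-- The index set of the frame: the point evaluations of the derivative, and the value at the
origin. -/
abbrev FrameIndex : Type := ℂ ⊕ Unit

/-- Area measure on the derivative part, a unit mass for the value at the origin. -/
def frameMeasure : Measure FrameIndex :=
  Measure.map Sum.inl (volume : Measure ℂ) + Measure.dirac (Sum.inr ())

lemma lintegral_frameMeasure (f : FrameIndex → ℝ≥0∞) :
    ∫⁻ x, f x ∂frameMeasure = (∫⁻ z : ℂ, f (Sum.inl z)) + f (Sum.inr ()) := by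
  have h : MeasurableSingletonClass FrameIndex := by
    refine ⟨?_⟩
    rintro (z | u)
    · rw [← Set.image_singleton]
      exact (measurableSet_singleton z).inl_image
    · rw [← Set.image_singleton]
      exact (measurableSet_singleton u).inr_image
  rw [frameMeasure, lintegral_add_measure, lintegral_dirac]
  congr 1
  exact MeasurableEmbedding.lintegral_map ⟨Sum.inl_injective, measurable_inl,
    fun _ hs => hs.inl_image⟩ f

/-- The vectors of the frame: normalized evaluations of the derivative, and the constant `1`. -/
def frameVec (hα : 0 < α) : FrameIndex → FockSpace α :=
  Sum.elim (derivUnitVec hα) fun _ => oneVec hα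

/-- The directions to which the adjoint of an operator `A` with `(A f)' = (f' ∘ ψ) G` and
`(A f) 0 = ⟨ℓ, f⟩` maps the frame vectors. Where `G` vanishes the direction is irrelevant and set to
zero, so that the upper frame bound also holds for `G = 0` and constant `ψ`. -/
def imageVec (hα : 0 < α) (G ψ : ℂ → ℂ) (ℓ : FockSpace α) : FrameIndex → FockSpace α :=
  open Classical in
  Sum.elim (fun z => if G z = 0 then 0 else derivUnitVec hα (ψ z))
    fun _ => ((‖ℓ‖⁻¹ : ℝ) : ℂ) • ℓ

/-- The factor `φ` in `⟨k_x, A f⟩ = φ x * ⟨η_x, f⟩`, where `A` is an operator as in `imageVec`, the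
`k_x` are the frame vectors and the `η_x` are their images `imageVec`. -/
def multiplier (α : ℝ) (G ψ : ℂ → ℂ) (ℓ : FockSpace α) : FrameIndex → ℂ :=
  Sum.elim (fun z => G z *
      ((Real.sqrt (derivNormSq α ‖ψ z‖) / Real.sqrt (derivNormSq α ‖z‖) : ℝ) : ℂ))
    fun _ => (‖ℓ‖ : ℂ)

/-- `G` vanishes identically, or `ψ` is a nonconstant affine map. These are the symbols for which
the images of the frame vectors satisfy an upper frame bound. -/
def IsAdmissible (G ψ : ℂ → ℂ) : Prop :=
  (∀ z, G z = 0) ∨ ∃ a b : ℂ, a ≠ 0 ∧ ∀ z, ψ z = a * z + b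

lemma exists_lintegral_comp_affine {a : ℂ} (ha : a ≠ 0) (b : ℂ) : ∃ C : ℝ≥0∞, C ≠ ⊤ ∧
    ∀ f : ℂ → ℝ≥0∞, Measurable f → ∫⁻ z, f (a * z + b) = C * ∫⁻ z, f z := by
  let e : ℂ ≃ₗ[ℝ] ℂ := (LinearEquiv.smulOfNeZero ℂ ℂ a ha).restrictScalars ℝ
  refine ⟨ENNReal.ofReal |(LinearMap.det (e : ℂ →ₗ[ℝ] ℂ))⁻¹|, ENNReal.ofReal_ne_top, fun f hf => ?_⟩
  have h1 := Measure.map_linearMap_addHaar_eq_smul_addHaar (volume : Measure ℂ)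
    (f := (e : ℂ →ₗ[ℝ] ℂ)) (LinearEquiv.isUnit_det' e).ne_zero
  have he : Measurable (e : ℂ →ₗ[ℝ] ℂ) := by
    show Measurable fun z : ℂ => a * z
    fun_prop
  have h2 := lintegral_map (μ := (volume : Measure ℂ)) (f := fun z => f (z + b)) (by fun_prop) he
  rw [h1, lintegral_smul_measure, lintegral_add_right_eq_self f b] at h2
  exact h2.symm

lemma exists_frameData (hα : 0 < α) {G ψ : ℂ → ℂ} (hG : Continuous G) (hψ : Continuous ψ)
    (h : IsAdmissible G ψ) (ℓ : FockSpace α) :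
    ∃ c C, FrameData frameMeasure (frameVec hα) (imageVec hα G ψ ℓ) (multiplier α G ψ ℓ) c C := by
  classical
  have hA : ∃ A : ℝ≥0∞, A ≠ ⊤ ∧ ∀ f : FockSpace α,
      ∫⁻ z, ‖inner ℂ (imageVec hα G ψ ℓ (Sum.inl z)) f‖ₑ ^ 2 ≤ A * ‖f‖ₑ ^ 2 := by
    rcases h with h | ⟨a, b, ha, hab⟩
    · exact ⟨0, by simp, fun f => by simp [imageVec, h]⟩
    · obtain ⟨C, hC, hCf⟩ := exists_lintegral_comp_affine ha b
      refine ⟨C * ENNReal.ofReal (2 * Real.pi / α), ENNReal.mul_ne_top hC ENNReal.ofReal_ne_top,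
        fun f => ?_⟩
      rw [mul_assoc]
      refine le_trans ?_ (mul_le_mul_right (lintegral_inner_derivUnitVec_le hα f) C)
      rw [← hCf _ ((continuous_inner_derivUnitVec hα f).enorm.measurable.pow_const 2)]
      refine lintegral_mono fun z => ?_
      simp only [imageVec, Sum.elim_inl, ← hab]
      split_ifs
      · simp
      · exact le_rfl
  obtain ⟨A, hA, hAf⟩ := hA
  have hℓ : ‖((‖ℓ‖⁻¹ : ℝ) : ℂ) • ℓ‖ ≤ 1 := by
    rw [norm_smul, Complex.norm_real, Real.norm_of_nonneg (by positivity)]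
    exact inv_mul_le_one
  have hle {v : FockSpace α} (hv : ‖v‖ ≤ 1) (f : FockSpace α) : ‖inner ℂ v f‖ₑ ^ 2 ≤ ‖f‖ₑ ^ 2 := by
    gcongr
    rw [← ofReal_norm, ← ofReal_norm]
    exact ENNReal.ofReal_le_ofReal ((norm_inner_le_norm _ _).trans
      (mul_le_of_le_one_left (norm_nonneg _) hv))
  refine ⟨min 1 (ENNReal.ofReal (Real.pi / (2 * α))),
    ENNReal.ofReal (2 * Real.pi / α) + A + 1, ?_, ?_, ?_, ?_, ?_, ?_, ?_, ?_, ?_, ?_, ?_, ?_⟩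
  · have : 0 < Real.pi / (2 * α) := by positivity
    exact (lt_min one_pos (ENNReal.ofReal_pos.2 this)).ne'
  · simp
  · exact ENNReal.add_ne_top.2 ⟨ENNReal.add_ne_top.2 ⟨ENNReal.ofReal_ne_top, hA⟩, by simp⟩
  · refine measurable_fun_sum ?_ measurable_const
    have := hG.measurable
    have := hψ.measurable
    simp only [Function.comp_def, multiplier, Sum.elim_inl]
    fun_prop
  · intro f
    exact measurable_fun_sum (continuous_inner_derivUnitVec hα f).measurable
      (measurable_of_finite _)
  · intro f
    refine measurable_fun_sum ?_ (measurable_of_finite _)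
    simp only [Function.comp_def, imageVec, Sum.elim_inl, apply_ite (fun v => inner ℂ v f),
      inner_zero_left]
    exact Measurable.ite (hG.measurable (measurableSet_singleton 0)) measurable_const
      ((continuous_inner_derivUnitVec hα f).comp hψ).measurable
  · rintro (z | _)
    · exact (norm_derivUnitVec hα z).le
    · exact (norm_oneVec hα).le
  · rintro (z | _)
    · simp only [imageVec, Sum.elim_inl]
      split_ifs
      · simp
      · exact (norm_derivUnitVec hα _).le
    · exact hℓ
  · rintro (z | _) hx
    · have hz : G z ≠ 0 := fun h0 => hx (by simp [multiplier, h0])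
      simp only [imageVec, Sum.elim_inl, if_neg hz, norm_derivUnitVec]
    · have hx : ‖ℓ‖ ≠ 0 := by simpa [multiplier] using hx
      simp only [imageVec, Sum.elim_inr]
      rw [norm_smul, Complex.norm_real, Real.norm_of_nonneg (by positivity), inv_mul_cancel₀ hx]
  · intro f
    rw [lintegral_frameMeasure, enorm_sq_eq_add_tsum hα f, mul_add, add_comm]
    simp only [frameVec, Sum.elim_inl, Sum.elim_inr, enorm_inner_derivUnitVec_sq, inner_oneVec]
    refine add_le_add ?_ ?_
    · refine le_trans ?_ (le_lintegral_deriv_sq hα (differentiable_entireRep f))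
      gcongr
      exact min_le_right _ _
    · exact mul_le_of_le_one_left' (min_le_left _ _)
  · intro f
    rw [lintegral_frameMeasure, add_mul, add_mul, one_mul]
    exact add_le_add ((lintegral_inner_derivUnitVec_le hα f).trans le_self_add)
      (hle (norm_oneVec hα).le f)
  · intro f
    rw [lintegral_frameMeasure, add_mul, add_mul, one_mul]
    exact add_le_add ((hAf f).trans le_add_self) (hle hℓ f)

/-! ### Integrability of the multiplier -/

lemma norm_multiplier_inl_rpow (hα : 0 < α) (G ψ : ℂ → ℂ) (ℓ : FockSpace α) (p : ℝ) (z : ℂ) :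
    ‖multiplier α G ψ ℓ (Sum.inl z)‖ ^ p = weight α p G ψ z *
      ((1 + α * ‖ψ z‖ ^ 2) / (1 + α * ‖z‖ ^ 2)) ^ (p / 2) := by
  have h1 : Real.sqrt (derivNormSq α ‖ψ z‖) / Real.sqrt (derivNormSq α ‖z‖) =
      Real.sqrt ((1 + α * ‖ψ z‖ ^ 2) / (1 + α * ‖z‖ ^ 2) *
        Real.exp (α * (‖ψ z‖ ^ 2 - ‖z‖ ^ 2))) := by
    rw [← Real.sqrt_div (derivNormSq_pos hα _).le]
    congr 1
    have h2 : 1 + α * ‖z‖ ^ 2 ≠ 0 := by positivity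
    rw [derivNormSq, derivNormSq, mul_sub, Real.exp_sub]
    field_simp
  simp only [multiplier, Sum.elim_inl]
  rw [h1, norm_mul, Complex.norm_real, Real.norm_of_nonneg (Real.sqrt_nonneg _),
    Real.mul_rpow (norm_nonneg _) (Real.sqrt_nonneg _), Real.sqrt_eq_rpow,
    ← Real.rpow_mul (by positivity), Real.mul_rpow (by positivity) (Real.exp_pos _).le,
    ← Real.exp_mul, weight, show 1 / 2 * p = p / 2 by ring,
    show α * (‖ψ z‖ ^ 2 - ‖z‖ ^ 2) * (p / 2) = p * α / 2 * (‖ψ z‖ ^ 2 - ‖z‖ ^ 2) by ring]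
  ring

lemma exists_one_add_sq_le (hα : 0 < α) (a b : ℂ) :
    ∃ M : ℝ, 0 < M ∧ ∀ z, 1 + α * ‖a * z + b‖ ^ 2 ≤ M * (1 + α * ‖z‖ ^ 2) := by
  refine ⟨1 + 2 * ‖a‖ ^ 2 + 2 * α * ‖b‖ ^ 2, by positivity, fun z => ?_⟩
  have h1 : ‖a * z + b‖ ≤ ‖a‖ * ‖z‖ + ‖b‖ := (norm_add_le _ _).trans (by rw [norm_mul])
  have h2 : ‖a * z + b‖ ^ 2 ≤ 2 * (‖a‖ ^ 2 * ‖z‖ ^ 2) + 2 * ‖b‖ ^ 2 := by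
    have h3 : ‖a * z + b‖ ^ 2 ≤ (‖a‖ * ‖z‖ + ‖b‖) ^ 2 := by gcongr
    nlinarith [sq_nonneg (‖a‖ * ‖z‖ - ‖b‖)]
  have h3 : 0 ≤ α * ‖a‖ ^ 2 := by positivity
  have h4 : 0 ≤ α * ‖z‖ ^ 2 := by positivity
  have h5 : 0 ≤ α * ‖b‖ ^ 2 * (α * ‖z‖ ^ 2) := by positivity
  have h6 := mul_le_mul_of_nonneg_left h2 hα.le
  nlinarith [sq_nonneg ‖a‖]

/-- For admissible symbols the weight is comparable to `|φ|^p`: for a nonconstant affine `ψ` both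
`ψ` and its inverse satisfy `exists_one_add_sq_le`. -/
lemma exists_multiplier_bounds (hα : 0 < α) {G ψ : ℂ → ℂ} (h : IsAdmissible G ψ)
    (ℓ : FockSpace α) {p : ℝ} (hp : 0 < p) : ∃ m M : ℝ, 0 < m ∧ 0 < M ∧ ∀ z,
      m * weight α p G ψ z ≤ ‖multiplier α G ψ ℓ (Sum.inl z)‖ ^ p ∧
      ‖multiplier α G ψ ℓ (Sum.inl z)‖ ^ p ≤ M * weight α p G ψ z := by
  rcases h with h | ⟨a, b, ha, hab⟩
  · refine ⟨1, 1, one_pos, one_pos, fun z => ?_⟩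
    simp [multiplier, weight, h, Real.zero_rpow hp.ne']
  · obtain ⟨M, hM, hMz⟩ := exists_one_add_sq_le hα a b
    obtain ⟨N, hN, hNz⟩ := exists_one_add_sq_le hα a⁻¹ (-(a⁻¹ * b))
    refine ⟨(N⁻¹) ^ (p / 2), M ^ (p / 2), by positivity, by positivity, fun z => ?_⟩
    have h1 : 0 < 1 + α * ‖z‖ ^ 2 := by positivity
    have h2 : 1 + α * ‖z‖ ^ 2 ≤ N * (1 + α * ‖ψ z‖ ^ 2) := by
      have h3 := hNz (ψ z)
      rwa [show a⁻¹ * ψ z + -(a⁻¹ * b) = z by rw [hab]; field_simp; ring] at h3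
    have h3 := weight_nonneg α p G ψ z
    rw [norm_multiplier_inl_rpow hα, mul_comm _ (weight α p G ψ z), mul_comm _ (weight α p G ψ z)]
    refine ⟨mul_le_mul_of_nonneg_left ?_ h3, mul_le_mul_of_nonneg_left ?_ h3⟩
    · refine Real.rpow_le_rpow (by positivity) ?_ (by positivity)
      rw [le_div_iff₀ h1, inv_mul_le_iff₀ hN]
      exact h2
    · refine Real.rpow_le_rpow (by positivity) ?_ (by positivity)
      rw [div_le_iff₀ h1, hab]
      exact hMz z

lemma lintegral_multiplier_lt_top_iff (hα : 0 < α) {G ψ : ℂ → ℂ} (h : IsAdmissible G ψ)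
    (ℓ : FockSpace α) {p : ℝ} (hp : 0 < p) :
    ∫⁻ x, ‖multiplier α G ψ ℓ x‖ₑ ^ p ∂frameMeasure < ⊤ ↔
      ∫⁻ z, ENNReal.ofReal (weight α p G ψ z) < ⊤ := by
  obtain ⟨m, M, hm, hM, hz⟩ := exists_multiplier_bounds hα h ℓ hp
  have h1 (x : FrameIndex) : ‖multiplier α G ψ ℓ x‖ₑ ^ p =
      ENNReal.ofReal (‖multiplier α G ψ ℓ x‖ ^ p) := by
    rw [← ofReal_norm, ENNReal.ofReal_rpow_of_nonneg (norm_nonneg _) hp.le]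
  rw [lintegral_frameMeasure]
  simp only [h1]
  constructor
  · intro hlt
    have h2 := (le_self_add.trans_lt hlt)
    have h3 : ENNReal.ofReal m * ∫⁻ z, ENNReal.ofReal (weight α p G ψ z) < ⊤ := by
      rw [← lintegral_const_mul' _ _ ENNReal.ofReal_ne_top]
      refine (lintegral_mono fun z => ?_).trans_lt h2
      rw [← ENNReal.ofReal_mul hm.le]
      exact ENNReal.ofReal_le_ofReal (hz z).1
    exact ENNReal.lt_top_of_mul_ne_top_right h3.ne (ENNReal.ofReal_pos.2 hm).ne'
  · intro hlt
    refine ENNReal.add_lt_top.2 ⟨?_, ENNReal.ofReal_lt_top⟩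
    refine lt_of_le_of_lt ?_ (ENNReal.mul_lt_top (ENNReal.ofReal_lt_top (r := M)) hlt)
    rw [← lintegral_const_mul' _ _ ENNReal.ofReal_ne_top]
    refine lintegral_mono fun z => ?_
    rw [← ENNReal.ofReal_mul hM.le]
    exact ENNReal.ofReal_le_ofReal (hz z).2

/-- For admissible symbols an integrable weight makes the multiplier bounded. -/
lemma exists_norm_multiplier_le (hα : 0 < α) {G ψ : ℂ → ℂ} (hG : Differentiable ℂ G)
    (h : IsAdmissible G ψ) (ℓ : FockSpace α) {p : ℝ} (hp : 0 < p)
    (hw : ∫⁻ z, ENNReal.ofReal (weight α p G ψ z) < ⊤) :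
    ∃ K : ℝ, ∀ x, ‖multiplier α G ψ ℓ x‖ ≤ K := by
  have hK : ∃ K : ℝ, ∀ z, weight α p G ψ z ≤ K := by
    rcases h with h | ⟨a, b, -, hab⟩
    · exact ⟨0, fun z => by simp [weight, h, Real.zero_rpow hp.ne']⟩
    · obtain rfl : ψ = fun z => a * z + b := funext hab
      exact exists_weight_le hp hG a b hw
  obtain ⟨K, hK⟩ := hK
  obtain ⟨m, M, -, hM, hz⟩ := exists_multiplier_bounds hα h ℓ hp
  refine ⟨max ((M * K) ^ p⁻¹) ‖ℓ‖, ?_⟩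
  rintro (z | _)
  · refine le_trans ?_ (le_max_left _ _)
    have hK0 : 0 ≤ K := (weight_nonneg α p G ψ z).trans (hK z)
    rw [Real.le_rpow_inv_iff_of_pos (norm_nonneg _) (by positivity) hp]
    exact (hz z).2.trans (by gcongr; exact hK z)
  · refine le_trans (le_of_eq ?_) (le_max_right _ _)
    simp [multiplier]

lemma lintegral_rpow_lt_top_of_le {X : Type*} [MeasurableSpace X] {μ : Measure X} {φ : X → ℂ}
    {K : ℝ} (hK : ∀ x, ‖φ x‖ ≤ K) {p q : ℝ} (hp : 0 < p) (hpq : p ≤ q)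
    (h : ∫⁻ x, ‖φ x‖ₑ ^ p ∂μ < ⊤) : ∫⁻ x, ‖φ x‖ₑ ^ q ∂μ < ⊤ := by
  have hC : ENNReal.ofReal K ^ (q - p) ≠ ⊤ :=
    ENNReal.rpow_ne_top_of_nonneg (by linarith) ENNReal.ofReal_ne_top
  refine lt_of_le_of_lt ?_ (ENNReal.mul_lt_top hC.lt_top h)
  rw [← lintegral_const_mul' _ _ hC]
  refine lintegral_mono fun x => ?_
  rw [show q = (q - p) + p by ring, ENNReal.rpow_add_of_nonneg _ _ (by linarith) hp.le,
    add_sub_cancel_right]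
  gcongr
  · rw [← ofReal_norm]
    exact ENNReal.ofReal_le_ofReal (hK x)

/-! ### Operators with a prescribed derivative -/

/-- The operators covered by the argument: `(A F)' = (F' ∘ ψ) G` for entire `F`, and
`f ↦ (A f) 0` is the bounded functional `⟨ℓ, ·⟩` on the Fock space. -/
structure IsVolterra (α : ℝ) (A : (ℂ → ℂ) → ℂ → ℂ) (G ψ : ℂ → ℂ) (ℓ : FockSpace α) : Prop where
  differentiable_G : Differentiable ℂ G
  differentiable_ψ : Differentiable ℂ ψ
  hasDerivAt : ∀ F, Differentiable ℂ F → ∀ z, HasDerivAt (A F) (deriv F (ψ z) * G z) z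
  apply_zero : ∀ f : FockSpace α, A (entireRep f) 0 = inner ℂ ℓ f

variable {A : (ℂ → ℂ) → ℂ → ℂ} {G ψ : ℂ → ℂ} {ℓ : FockSpace α}

lemma IsVolterra.differentiable (hA : IsVolterra α A G ψ ℓ) {F : ℂ → ℂ} (hF : Differentiable ℂ F) :
    Differentiable ℂ (A F) := fun z => (hA.hasDerivAt F hF z).differentiableAt

lemma inner_inl_eq (hα : 0 < α) (G ψ : ℂ → ℂ) (ℓ : FockSpace α) (z : ℂ) (f : FockSpace α) :
    (((Real.sqrt (derivNormSq α ‖z‖))⁻¹ : ℝ) : ℂ) * (deriv (entireRep f) (ψ z) * G z) =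
      multiplier α G ψ ℓ (Sum.inl z) * inner ℂ (imageVec hα G ψ ℓ (Sum.inl z)) f := by
  simp only [multiplier, imageVec, Sum.elim_inl]
  split_ifs with h
  · simp [h]
  · have h1 := (Real.sqrt_pos.2 (derivNormSq_pos hα ‖ψ z‖)).ne'
    rw [inner_derivUnitVec]
    push_cast
    have h2 : ((Real.sqrt (derivNormSq α ‖ψ z‖) : ℝ) : ℂ) ≠ 0 := by exact_mod_cast h1
    field_simp

lemma IsVolterra.inner_eq (hα : 0 < α) (hA : IsVolterra α A G ψ ℓ) {f h : FockSpace α}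
    (hfh : entireRep h = A (entireRep f)) (x : FrameIndex) :
    inner ℂ (frameVec hα x) h = multiplier α G ψ ℓ x * inner ℂ (imageVec hα G ψ ℓ x) f := by
  rcases x with z | _
  · rw [← inner_inl_eq, ← (hA.hasDerivAt _ (differentiable_entireRep f) z).deriv, ← hfh,
      ← inner_derivUnitVec hα]
    rfl
  · simp only [frameVec, multiplier, imageVec, Sum.elim_inr]
    rw [inner_oneVec, hfh, hA.apply_zero]
    have := inner_smul_left (𝕜 := ℂ) (E := FockSpace α) ℓ f ((‖ℓ‖⁻¹ : ℝ) : ℂ)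
    rw [this, Complex.conj_ofReal]
    by_cases h0 : ℓ = 0
    · simp [h0]
    · have h1 : (‖ℓ‖ : ℂ) ≠ 0 := by exact_mod_cast (norm_ne_zero_iff.2 h0)
      push_cast
      field_simp

/-- A bounded operator forces `ψ` to be affine or `G` to vanish: testing on the normalized
derivative evaluations shows that the multiplier is bounded. -/
lemma IsVolterra.isAdmissible (hα : 0 < α) (hA : IsVolterra α A G ψ ℓ)
    (hψ : ¬ ∃ c, ∀ z, ψ z = c) {T : FockSpace α →L[ℂ] FockSpace α}
    (hT : ∀ f, entireRep (T f) = A (entireRep f)) : IsAdmissible G ψ := by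
  by_cases hG : ∀ z, G z = 0
  · exact Or.inl hG
  push Not at hG
  obtain ⟨w, hw⟩ := hG
  have hbound (z : ℂ) : ‖multiplier α G ψ ℓ (Sum.inl z)‖ ≤ ‖T‖ := by
    by_cases hz : G z = 0
    · have h1 : multiplier α G ψ ℓ (Sum.inl z) = 0 := by simp [multiplier, hz]
      rw [h1, norm_zero]
      exact norm_nonneg T
    · have h1 := hA.inner_eq hα (hT (derivUnitVec hα (ψ z))) (Sum.inl z)
      simp only [imageVec, Sum.elim_inl, if_neg hz, frameVec] at h1
      have h4 := inner_self_eq_norm_sq_to_K (𝕜 := ℂ) (derivUnitVec hα (ψ z))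
      rw [h4, norm_derivUnitVec] at h1
      have h2 : ‖multiplier α G ψ ℓ (Sum.inl z)‖ =
          ‖inner ℂ (derivUnitVec hα z) (T (derivUnitVec hα (ψ z)))‖ := by
        rw [h1]
        simp
      rw [h2]
      refine (norm_inner_le_norm (𝕜 := ℂ) (E := FockSpace α) _ _).trans ?_
      have h3 := T.le_opNorm (derivUnitVec hα (ψ z))
      rw [norm_derivUnitVec, mul_one] at h3
      rwa [norm_derivUnitVec, one_mul]
  obtain ⟨a, b, hab⟩ := exists_affine_of_le hα hA.differentiable_G hA.differentiable_ψ hw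
    (K := ‖T‖ ^ (2 : ℝ)) fun z => by
      have h1 := norm_multiplier_inl_rpow hα G ψ ℓ 2 z
      have h2 : ‖multiplier α G ψ ℓ (Sum.inl z)‖ ^ (2 : ℝ) ≤ ‖T‖ ^ (2 : ℝ) :=
        Real.rpow_le_rpow (norm_nonneg _) (hbound z) zero_le_two
      rw [h1, div_self two_ne_zero, Real.rpow_one, mul_div_assoc',
        div_le_iff₀ (by positivity)] at h2
      refine le_trans ?_ h2
      refine le_mul_of_one_le_right (weight_nonneg _ _ _ _ _) ?_
      have : 0 ≤ α * ‖ψ z‖ ^ 2 := by positivity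
      linarith
  refine Or.inr ⟨a, b, ?_, hab⟩
  rintro rfl
  exact hψ ⟨b, fun z => by rw [hab, zero_mul, zero_add]⟩

/-- With a bounded multiplier, `A` maps the Fock space into itself. -/
lemma IsVolterra.exists_entireRep_eq (hα : 0 < α) (hA : IsVolterra α A G ψ ℓ)
    (h : IsAdmissible G ψ) {K : ℝ} (hK : ∀ x, ‖multiplier α G ψ ℓ x‖ ≤ K) (f : FockSpace α) :
    ∃ u : FockSpace α, entireRep u = A (entireRep f) := by
  have hAf := hA.differentiable (differentiable_entireRep f)
  obtain ⟨c, C, D⟩ := exists_frameData hα hA.differentiable_G.continuous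
    hA.differentiable_ψ.continuous h ℓ
  have h1 : ∫⁻ z, ‖deriv (A (entireRep f)) z‖ₑ ^ 2 *
      ENNReal.ofReal ((derivNormSq α ‖z‖)⁻¹) < ⊤ := by
    have h2 : ∫⁻ z, ‖deriv (A (entireRep f)) z‖ₑ ^ 2 * ENNReal.ofReal ((derivNormSq α ‖z‖)⁻¹) ≤
        ENNReal.ofReal K ^ 2 * ∫⁻ x, ‖inner ℂ (imageVec hα G ψ ℓ x) f‖ₑ ^ 2 ∂frameMeasure := by
      rw [lintegral_frameMeasure, mul_add]
      refine le_trans ?_ le_self_add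
      rw [← lintegral_const_mul' _ _ (by simp)]
      refine lintegral_mono fun z => ?_
      have h3 : ENNReal.ofReal ((derivNormSq α ‖z‖)⁻¹) =
          ‖(((Real.sqrt (derivNormSq α ‖z‖))⁻¹ : ℝ) : ℂ)‖ₑ ^ 2 := by
        have h0 := derivNormSq_pos hα ‖z‖
        rw [← ofReal_norm, Complex.norm_real, Real.norm_of_nonneg (by positivity),
          ← ENNReal.ofReal_pow (by positivity), inv_pow, Real.sq_sqrt h0.le]
      rw [(hA.hasDerivAt _ (differentiable_entireRep f) z).deriv, h3, ← mul_pow, ← mul_pow,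
        ← enorm_mul, mul_comm, inner_inl_eq hα G ψ ℓ, enorm_mul]
      gcongr
      rw [← ofReal_norm]
      exact ENNReal.ofReal_le_ofReal (hK _)
    refine h2.trans_lt (ENNReal.mul_lt_top (by simp) ((D.upper_η f).trans_lt ?_))
    exact ENNReal.mul_lt_top D.C_ne_top.lt_top (by simp)
  have h2 := (le_lintegral_deriv_sq hα hAf).trans_lt h1
  have h3 : ENNReal.ofReal (Real.pi / (2 * α)) ≠ 0 := by
    have : 0 < Real.pi / (2 * α) := by positivity
    exact (ENNReal.ofReal_pos.2 this).ne'
  have h4 := ENNReal.lt_top_of_mul_ne_top_right h2.ne h3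
  obtain ⟨u, hu⟩ := exists_fockSpace (α := α) hAf (by
    rw [lintegral_enorm_sq_gaussianMeasure hα hAf, tsum_eq_zero_add' ENNReal.summable]
    exact ENNReal.add_lt_top.2 ⟨ENNReal.mul_lt_top (by simp) (by simp), h4⟩)
  exact ⟨u, entireRep_eq hα hAf hu⟩

/-- The induced map is linear because the frame separates points. -/
lemma IsVolterra.exists_linearMap (hα : 0 < α) (hA : IsVolterra α A G ψ ℓ)
    (h : IsAdmissible G ψ) {K : ℝ} (hK : ∀ x, ‖multiplier α G ψ ℓ x‖ ≤ K) :
    ∃ T : FockSpace α →ₗ[ℂ] FockSpace α, ∀ f, entireRep (T f) = A (entireRep f) := by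
  choose T hT using hA.exists_entireRep_eq hα h hK
  obtain ⟨c, C, D⟩ := exists_frameData hα hA.differentiable_G.continuous
    hA.differentiable_ψ.continuous h ℓ
  have hext {u v : FockSpace α} (huv : ∀ x, inner ℂ (frameVec hα x) u = inner ℂ (frameVec hα x) v) :
      u = v := by
    rw [← sub_eq_zero]
    have h1 := D.lower (u - v)
    simp only [inner_sub_right, huv, sub_self] at h1
    have h2 : ‖u - v‖ₑ = 0 := by simpa [D.c_ne_zero] using h1
    exact enorm_eq_zero.1 h2
  have hin := fun f => hA.inner_eq hα (hT f)
  refine ⟨{ toFun := T, map_add' := fun f k => hext fun x => ?_,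
            map_smul' := fun c f => hext fun x => ?_ }, hT⟩
  · rw [inner_add_right, hin, hin, hin, inner_add_right, mul_add]
  · rw [hin]
    have h1 := inner_smul_right (𝕜 := ℂ) (E := FockSpace α)
    rw [h1, RingHom.id_apply, h1, hin]
    ring

/-- The Schatten class criterion for the operators with a prescribed derivative. -/
theorem IsVolterra.actsInSchatten_iff (hα : 0 < α) (hA : IsVolterra α A G ψ ℓ)
    (h : IsAdmissible G ψ) {p : ℝ} (hp : 0 < p) :
    ActsInSchatten α p A ↔ ∫⁻ z, ENNReal.ofReal (weight α p G ψ z) < ⊤ := by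
  have hcomplete := completeSpace_fockSpace hα
  obtain ⟨c, C, D⟩ := exists_frameData hα hA.differentiable_G.continuous
    hA.differentiable_ψ.continuous h ℓ
  constructor
  · rintro ⟨T, hT, hTp⟩
    have hTf (f : FockSpace α) : entireRep (T f) = A (entireRep f) :=
      entireRep_eq hα (hA.differentiable (differentiable_entireRep f))
        (hT f _ (differentiable_entireRep f) (coe_ae_eq_entireRep f))
    rw [← lintegral_multiplier_lt_top_iff hα h ℓ hp]
    exact D.lintegral_lt_top (fun x f => hA.inner_eq hα (hTf f) x) hp hTp
  · intro hw
    obtain ⟨K, hK⟩ := exists_norm_multiplier_le hα hA.differentiable_G h ℓ hp hw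
    obtain ⟨T, hT⟩ := hA.exists_linearMap hα h hK
    have hφ := (lintegral_multiplier_lt_top_iff hα h ℓ hp).2 hw
    obtain ⟨T', hT', hc⟩ := D.exists_isCompactOperator (T := T)
      (fun x f => hA.inner_eq hα (hT f) x) (le_max_right p 2)
      (lintegral_rpow_lt_top_of_le hK hp (le_max_left p 2) hφ)
    refine ⟨T', fun f F hF hfF => ?_, D.isSchatten (fun x f => ?_) hp hc hφ⟩
    · rw [← entireRep_eq hα hF hfF, ← hT, hT']
      exact coe_ae_eq_entireRep _
    · rw [hT']
      exact hA.inner_eq hα (hT f) x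

/-- For nonconstant `ψ` both sides of the criterion force admissibility. -/
theorem IsVolterra.actsInSchatten_iff_of_not_const (hα : 0 < α) (hA : IsVolterra α A G ψ ℓ)
    (hψ : ¬ ∃ c, ∀ z, ψ z = c) {p : ℝ} (hp : 0 < p) :
    ActsInSchatten α p A ↔ ∫⁻ z, ENNReal.ofReal (weight α p G ψ z) < ⊤ := by
  constructor
  · rintro ⟨T, hT, hTp⟩
    refine (hA.actsInSchatten_iff hα (hA.isAdmissible hα hψ (T := T) fun f => ?_) hp).1 ⟨T, hT, hTp⟩
    exact entireRep_eq hα (hA.differentiable (differentiable_entireRep f))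
      (hT f _ (differentiable_entireRep f) (coe_ae_eq_entireRep f))
  · intro hw
    refine (hA.actsInSchatten_iff hα ?_ hp).2 hw
    by_cases hG : ∀ z, G z = 0
    · exact Or.inl hG
    push Not at hG
    obtain ⟨w, hGw⟩ := hG
    obtain ⟨a, b, hab⟩ := exists_affine_of_lintegral hα hp hA.differentiable_G
      hA.differentiable_ψ hGw hw
    refine Or.inr ⟨a, b, ?_, hab⟩
    rintro rfl
    exact hψ ⟨b, fun z => by rw [hab, zero_mul, zero_add]⟩

/-! ### The two companion operators -/

/-- The functional `f ↦ ∫_0^{z₀} f' g dw` is bounded on the Fock space. -/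
lemma exists_inner_eq_lineIntegral (hα : 0 < α) {g : ℂ → ℂ} (hg : Continuous g) (z₀ : ℂ) :
    ∃ ℓ : FockSpace α, ∀ f : FockSpace α,
      lineIntegral (fun w => deriv (entireRep f) w * g w) z₀ = inner ℂ ℓ f := by
  have hcomplete := completeSpace_fockSpace hα
  have hcont : Continuous fun t : ℝ => Real.sqrt (derivNormSq α ‖(t : ℂ) * z₀‖) * ‖g (t * z₀)‖ := by
    fun_prop
  obtain ⟨K, hK⟩ := isCompact_Icc.exists_bound_of_continuousOn (s := Set.Icc (0 : ℝ) 1)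
    hcont.continuousOn
  choose v hv hvf using exists_derivVec hα
  have hadd (f h : FockSpace α) (w : ℂ) : deriv (entireRep (f + h)) w =
      deriv (entireRep f) w + deriv (entireRep h) w := by
    rw [entireRep_add hα, deriv_add (differentiable_entireRep f w) (differentiable_entireRep h w)]
  have hsmul (c : ℂ) (f : FockSpace α) (w : ℂ) : deriv (entireRep (c • f)) w =
      c * deriv (entireRep f) w := by
    rw [entireRep_smul hα, deriv_const_smul c (differentiable_entireRep f w), smul_eq_mul]
  have hc (f : FockSpace α) : Continuous fun w => deriv (entireRep f) w * g w :=
    (continuous_deriv_entireRep f).mul hg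
  let L : FockSpace α →L[ℂ] ℂ := LinearMap.mkContinuous
    { toFun := fun f => lineIntegral (fun w => deriv (entireRep f) w * g w) z₀
      map_add' := fun f h => by
        simp only [hadd, add_mul]
        exact lineIntegral_add (hc f) (hc h) z₀
      map_smul' := fun c f => by
        simp only [hsmul, mul_assoc]
        exact lineIntegral_const_mul c _ z₀ } (‖z₀‖ * K) fun f => by
      have h1 : ‖∫ t in (0 : ℝ)..1, deriv (entireRep f) (t * z₀) * g (t * z₀)‖ ≤
          K * ‖f‖ * |(1 : ℝ) - 0| := by
        refine intervalIntegral.norm_integral_le_of_norm_le_const fun t ht => ?_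
        rw [Set.uIoc_of_le zero_le_one] at ht
        have h2 := (le_abs_self _).trans (hK t ⟨ht.1.le, ht.2⟩)
        have h3 : ‖deriv (entireRep f) (t * z₀)‖ ≤
            Real.sqrt (derivNormSq α ‖(t : ℂ) * z₀‖) * ‖f‖ := by
          rw [← hvf, ← hv, Real.sqrt_sq (norm_nonneg _)]
          exact norm_inner_le_norm (𝕜 := ℂ) (E := FockSpace α) _ _
        rw [norm_mul]
        calc _ ≤ Real.sqrt (derivNormSq α ‖(t : ℂ) * z₀‖) * ‖f‖ * ‖g (t * z₀)‖ := by gcongr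
          _ = Real.sqrt (derivNormSq α ‖(t : ℂ) * z₀‖) * ‖g (t * z₀)‖ * ‖f‖ := by ring
          _ ≤ K * ‖f‖ := mul_le_mul_of_nonneg_right h2 (norm_nonneg f)
      rw [sub_zero, abs_one, mul_one] at h1
      show ‖lineIntegral _ z₀‖ ≤ _
      rw [lineIntegral, norm_mul, mul_assoc]
      exact mul_le_mul_of_nonneg_left h1 (norm_nonneg z₀)
  refine ⟨(InnerProductSpace.toDual ℂ (FockSpace α)).symm L, fun f => ?_⟩
  exact (InnerProductSpace.toDual_symm_apply (𝕜 := ℂ) (x := f) (y := L)).symm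

lemma isVolterra_companionI {g ψ : ℂ → ℂ} (hg : Differentiable ℂ g)
    (hψ : Differentiable ℂ ψ) : IsVolterra α (companionI g ψ) g ψ 0 where
  differentiable_G := hg
  differentiable_ψ := hψ
  hasDerivAt F hF := hasDerivAt_lineIntegral
    (h := fun w => deriv F (ψ w) * g w) ((hF.deriv.comp hψ).mul hg)
  apply_zero f := by
    have h := inner_zero_left (𝕜 := ℂ) (E := FockSpace α) f
    rw [h]
    exact lineIntegral_zero _

lemma exists_isVolterra_companionC (hα : 0 < α) {g ψ : ℂ → ℂ} (hg : Differentiable ℂ g)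
    (hψ : Differentiable ℂ ψ) :
    ∃ ℓ : FockSpace α, IsVolterra α (companionC g ψ) (fun z => g (ψ z) * deriv ψ z) ψ ℓ := by
  obtain ⟨ℓ, hℓ⟩ := exists_inner_eq_lineIntegral hα hg.continuous (ψ 0)
  refine ⟨ℓ, (hg.comp hψ).mul hψ.deriv, hψ, fun F hF z => ?_, hℓ⟩
  have h := (hasDerivAt_lineIntegral (hF.deriv.mul hg) (ψ z)).comp z (hψ z).hasDerivAt
  rw [← mul_assoc]
  exact h

lemma lintegral_weight_const_lt_top {p : ℝ} (hα : 0 < α) (hp : 0 < p) (g₀ c : ℂ) :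
    ∫⁻ z, ENNReal.ofReal (weight α p (fun _ => g₀) (fun _ => c) z) < ⊤ := by
  have h := lintegral_moment (α := p * α / 2) (by positivity) 0
  have h1 (z : ℂ) : weight α p (fun _ => g₀) (fun _ => c) z =
      ‖g₀‖ ^ p * Real.exp (p * α / 2 * ‖c‖ ^ 2) *
        (‖z‖ ^ (2 * 0) * Real.exp (-(p * α / 2) * ‖z‖ ^ 2)) := by
    rw [weight, mul_zero, pow_zero, one_mul, mul_assoc, ← Real.exp_add]
    congr 2
    ring
  simp only [h1]
  simp only [ENNReal.ofReal_mul (show 0 ≤ ‖g₀‖ ^ p * Real.exp (p * α / 2 * ‖c‖ ^ 2) by positivity)]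
  rw [lintegral_const_mul' _ _ ENNReal.ofReal_ne_top, h]
  exact ENNReal.mul_lt_top ENNReal.ofReal_lt_top ENNReal.ofReal_lt_top

/-- The derivative `ψ'` does not affect integrability: either weight can be integrable only if
`g ∘ ψ` vanishes or `ψ'` is a nonzero constant. -/
lemma lintegral_weight_mul_deriv_lt_top_iff {p : ℝ} (hα : 0 < α) (hp : 0 < p) {k ψ : ℂ → ℂ}
    (hk : Differentiable ℂ k) (hψ : Differentiable ℂ ψ) (hc : ¬ ∃ c, ∀ z, ψ z = c) :
    ∫⁻ z, ENNReal.ofReal (weight α p (fun z => k z * deriv ψ z) ψ z) < ⊤ ↔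
      ∫⁻ z, ENNReal.ofReal (weight α p k ψ z) < ⊤ := by
  by_cases h0 : ∀ z, k z * deriv ψ z = 0
  · -- a product of entire functions vanishes only if one of the factors does
    have h1 : (∀ z, k z = 0) ∨ ∀ z, deriv ψ z = 0 := by
      have h2 := AnalyticOnNhd.eq_zero_or_eq_zero_of_smul_eq_zero (U := Set.univ)
        (fun z _ => hk.analyticAt z) (fun z _ => hψ.deriv.analyticAt z) (fun z _ => h0 z)
        isPreconnected_univ
      simpa using h2
    rcases h1 with h1 | h1
    · simp [weight, h1, Real.zero_rpow hp.ne']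
    · exact absurd ⟨ψ 0, fun z => is_const_of_deriv_eq_zero hψ h1 z 0⟩ hc
  push Not at h0
  obtain ⟨w, hw⟩ := h0
  have haff (h : ∃ a b : ℂ, ∀ z, ψ z = a * z + b) :
      ∫⁻ z, ENNReal.ofReal (weight α p (fun z => k z * deriv ψ z) ψ z) < ⊤ ↔
        ∫⁻ z, ENNReal.ofReal (weight α p k ψ z) < ⊤ := by
    obtain ⟨a, b, hab⟩ := h
    have hd (z : ℂ) : deriv ψ z = a := by
      rw [show ψ = fun z => a * z + b from funext hab]
      simp
    have ha : a ≠ 0 := hd w ▸ right_ne_zero_of_mul hw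
    have h1 (z : ℂ) : weight α p (fun z => k z * deriv ψ z) ψ z = ‖a‖ ^ p * weight α p k ψ z := by
      simp only [weight, hd]
      rw [norm_mul, Real.mul_rpow (norm_nonneg _) (norm_nonneg _)]
      ring
    have ha' : 0 < ‖a‖ ^ p := Real.rpow_pos_of_pos (norm_pos_iff.2 ha) p
    simp only [h1, ENNReal.ofReal_mul ha'.le]
    rw [lintegral_const_mul' _ _ ENNReal.ofReal_ne_top]
    exact ⟨fun h => ENNReal.lt_top_of_mul_ne_top_right h.ne (ENNReal.ofReal_pos.2 ha').ne',
      fun h => ENNReal.mul_lt_top ENNReal.ofReal_lt_top h⟩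
  constructor
  · intro h
    exact (haff (exists_affine_of_lintegral hα hp (hk.mul hψ.deriv) hψ hw h)).1 h
  · intro h
    exact (haff (exists_affine_of_lintegral hα hp hk hψ (left_ne_zero_of_mul hw) h)).2 h

end FockVolterra

end

theorem theorem2 (α p : ℝ) (hα : 0 < α) (hp : 0 < p) (g ψ : ℂ → ℂ)
    (hg : Differentiable ℂ g) (hψ : Differentiable ℂ ψ) :
    ((¬ ∃ c : ℂ, ∀ z, ψ z = c) →
      (FockVolterra.ActsInSchatten α p (FockVolterra.companionI g ψ) ↔
        ∫⁻ z : ℂ, ENNReal.ofReal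
          (‖g z‖ ^ p * Real.exp (p * α / 2 * (‖ψ z‖ ^ 2 - ‖z‖ ^ 2))) < ⊤)) ∧
    (FockVolterra.ActsInSchatten α p (FockVolterra.companionC g ψ) ↔
      ∫⁻ z : ℂ, ENNReal.ofReal
        (‖g (ψ z)‖ ^ p * Real.exp (p * α / 2 * (‖ψ z‖ ^ 2 - ‖z‖ ^ 2))) < ⊤) := by
  refine ⟨fun hc =>
    (FockVolterra.isVolterra_companionI hg hψ).actsInSchatten_iff_of_not_const hα hc hp, ?_⟩
  obtain ⟨ℓ, hC⟩ := FockVolterra.exists_isVolterra_companionC hα hg hψ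
  by_cases hc : ∃ c, ∀ z, ψ z = c
  · -- for constant `ψ` the operator has rank at most one, and the integral is Gaussian
    obtain ⟨c, hc⟩ := hc
    obtain rfl : ψ = fun _ => c := funext hc
    have h0 (z : ℂ) : g c * deriv (fun _ : ℂ => c) z = 0 := by simp
    refine iff_of_true ((hC.actsInSchatten_iff hα (Or.inl h0) hp).2 ?_)
      (FockVolterra.lintegral_weight_const_lt_top hα hp (g c) c)
    simp [FockVolterra.weight, Real.zero_rpow hp.ne']
  · rw [hC.actsInSchatten_iff_of_not_const hα hc hp]
    exact FockVolterra.lintegral_weight_mul_deriv_lt_top_iff hα hp (k := fun z => g (ψ z))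
      (hg.comp hψ) hψ hc
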